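/- Let $0<\lambda<1$ be fixed. For $n\ge 2$ let $G(n,p)$ be the Erdős–Rényi random graph with $p=\frac{\lambda}{n-1}$, that is, the random graph on $n$ vertices in which each of the $\binom n2$ possible edges is present independently with probability $p$; write $\mathbb{E}_p$ for its expectation. For a vertex $v$ let $\mathscr{C}(v)$ be the connected component of $v$, let $|\mathscr{C}(v)|$ be its number of vertices, and let $\chi(p)=\mathbb{E}_p[|\mathscr{C}(v)|]$ be the susceptibility (by symmetry it does not depend on $v$). For a finite connected graph $H$ let $\mathrm{Sp}(H)=|\mathcal{E}(H)|-|\mathcal{V}(H)|+1$ be its number of surplus edges, where $\mathcal{E}(H)$ and $\mathcal{V}(H)$ are its edge set and its vertex set. Then, as $n\to\infty$, \begin{align*} \chi(p) &= \frac{1}{1-\lambda}-\frac{2\lambda^2-\lambda^4}{2(1-\lambda)^4}\,n^{-1}+O(n^{-2}),\\ \mathbb{E}_p\big[|\mathscr{C}(v)|^2\big] &= \frac{1}{(1-\lambda)^3}+O(n^{-1}),\\ \mathbb{E}_p\big[\mathrm{Sp}(\mathscr{C}(v))\big] &= \frac{\lambda^3}{2(1-\lambda)^2}\,n^{-1}+O(n^{-2}).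 \end{align*} Here $a_n=b_n+O(c_n)$ means that there is a finite constant $K$, which may depend on $\lambda$, such that $|a_n-b_n|\le K c_n$ for all $n\ge 2$. -/

import Mathlib

open MeasureTheory

/-- The cluster `𝒞(v)` of the vertex `v` in the graph `G`: the graph whose vertices are the vertices
that can be reached from `v` along edges of `G`, and whose edges are all edges of `G` between
these vertices. -/
def cluster {V : Type*} (G : SimpleGraph V) (v : V) : SimpleGraph {w : V | G.Reachable v w} :=
  G.induce {w : V | G.Reachable v w}

/-- The number `|𝒞(v)|` of vertices of the cluster of `v` in `G`. -/
noncomputable def clusterSize {V : Type*} (G : SimpleGraph V) (v : V) : ℕ :=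
  Nat.card {w : V | G.Reachable v w}

/-- The number of surplus edges `|E(H)| - |V(H)| + 1` of a (finite connected) graph `H`. -/
noncomputable def surplus {W : Type*} (H : SimpleGraph W) : ℤ :=
  (Nat.card H.edgeSet : ℤ) - (Nat.card W : ℤ) + 1

/-- The susceptibility `χ(p) = 𝔼_p |𝒞(v)|` of the Erdős–Rényi random graph `G(n, p)`, computed at
the vertex `v`; by symmetry the value does not depend on `v`. -/
noncomputable def susceptibility (n : ℕ) (p : unitInterval) (v : Fin n) : ℝ :=
  ∫ G, (clusterSize G v : ℝ) ∂(SimpleGraph.binomialRandom (Fin n) p)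

/-! Write `N = n - 1` and `q = 1 - p`. The cluster of `v` is a given set of `i + 1` vertices exactly
when that set is internally connected and sends no edge outside, so its size has the law `N.choose i
* c i * q ^ ((i + 1) * (N - i))`, where the connection probability `c i` does not involve `N`. Laws
for different `N` and the same `p` therefore differ by explicit factors, and everything follows from
comparing them; no branching process or exploration is used.

Removing one vertex (`clusterMean_succ`) gives `E[D] = 1` for `D k = (1 - (k - 1) / N) * q⁻¹ ^ k`.
Since `N * (D k - 1)` is `lam * k - (k - 1)` up to `O(k ^ 2 / N)`, this yields `(1 - lam) * E[k] ≈
1`; one more order of the expansion expresses the `1 / N` term of `E[k]` through `E[k ^ 2]`.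
Removing two vertices computes `E[D ^ 2]`: the second moment of `lam * k - (k - 1)` is `E[k - 1]` up
to `O(1 / N)`, which determines `E[k ^ 2]` (`exists_abs_moment_identities_le`).

The errors are controlled by a third moment bounded uniformly in `N` (`exists_clusterMean_cube_le`).
It comes from adding about `ε * N` vertices: that the larger law has mass one is an exponential
moment bound for the smaller law (`clusterMean_pow_le_one`).

For the surplus, whether a pair meets the cluster does not depend on whether that pair is itself an
edge. So the expected number of cluster edges is `p` times the expected number of pairs meeting the
cluster, a quadratic in the cluster size (`bernoulliSum_card_edges`). -/

/-! ### Expectations over random subsets of a finite set -/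

/-- The expectation of `f` at the random subset of `E` that contains each element independently with
probability `p`. -/
noncomputable def bernoulliSum {α : Type*} [DecidableEq α] (p : ℝ) (E : Finset α)
    (f : Finset α → ℝ) : ℝ :=
  ∑ F ∈ E.powerset, p ^ F.card * (1 - p) ^ (E \ F).card * f F

section BernoulliSum

variable {α : Type*} [DecidableEq α] {p : ℝ} {E : Finset α}

theorem bernoulliSum_congr {f g : Finset α → ℝ} (h : ∀ F ⊆ E, f F = g F) :
    bernoulliSum p E f = bernoulliSum p E g :=
  Finset.sum_congr rfl fun F hF => by rw [h F (Finset.mem_powerset.1 hF)]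

theorem bernoulliSum_add (f g : Finset α → ℝ) :
    bernoulliSum p E (fun F => f F + g F) = bernoulliSum p E f + bernoulliSum p E g := by
  simp only [bernoulliSum, mul_add, Finset.sum_add_distrib]

theorem bernoulliSum_sum {ι : Type*} (s : Finset ι) (f : ι → Finset α → ℝ) :
    bernoulliSum p E (fun F => ∑ i ∈ s, f i F) = ∑ i ∈ s, bernoulliSum p E (f i) := by
  simp only [bernoulliSum, Finset.mul_sum]
  exact Finset.sum_comm

theorem bernoulliSum_mul_right (f : Finset α → ℝ) (c : ℝ) :
    bernoulliSum p E (fun F => f F * c) = bernoulliSum p E f * c := by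
  simp only [bernoulliSum, Finset.sum_mul, mul_assoc]

theorem bernoulliSum_nonneg (hp0 : 0 ≤ p) (hp1 : p ≤ 1) {f : Finset α → ℝ} (hf : ∀ F, 0 ≤ f F) :
    0 ≤ bernoulliSum p E f := by
  have := sub_nonneg.2 hp1
  exact Finset.sum_nonneg fun F _ => mul_nonneg (by positivity) (hf F)

theorem bernoulliSum_insert {e : α} (he : e ∉ E) (f : Finset α → ℝ) :
    bernoulliSum p (insert e E) f =
      bernoulliSum p E (fun F => p * f (insert e F) + (1 - p) * f F) := by
  rw [bernoulliSum, Finset.sum_powerset_insert he, bernoulliSum, ← Finset.sum_add_distrib]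
  refine Finset.sum_congr rfl fun F hF => ?_
  have hF' := Finset.mem_powerset.1 hF
  have heF : e ∉ F := fun h => he (hF' h)
  have h1 : insert e E \ F = insert e (E \ F) := Finset.insert_sdiff_of_notMem _ heF
  have h2 : insert e E \ insert e F = E \ F := by
    ext x; simp only [Finset.mem_sdiff, Finset.mem_insert]; grind
  have h3 : e ∉ E \ F := fun h => he (Finset.mem_sdiff.1 h).1
  rw [h1, h2, Finset.card_insert_of_notMem h3, Finset.card_insert_of_notMem heF]
  ring

/-- Independence of disjoint edge sets, in the form of an iterated expectation. -/
theorem bernoulliSum_union {E' : Finset α} (h : Disjoint E E') (f : Finset α → ℝ) :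
    bernoulliSum p (E ∪ E') f =
      bernoulliSum p E (fun F => bernoulliSum p E' (fun F' => f (F ∪ F'))) := by
  induction E using Finset.induction_on generalizing f with
  | empty => simp [bernoulliSum]
  | insert e E he ih =>
    have hd := Finset.disjoint_insert_left.1 h
    have heu : e ∉ E ∪ E' := by simp [he, hd.1]
    rw [Finset.insert_union, bernoulliSum_insert heu, ih hd.2, bernoulliSum_insert he]
    refine bernoulliSum_congr fun F _ => ?_
    rw [bernoulliSum_add, mul_comm p, mul_comm (1 - p), ← bernoulliSum_mul_right,
      ← bernoulliSum_mul_right]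
    simp only [Finset.insert_union, mul_comm]

theorem bernoulliSum_const (c : ℝ) : bernoulliSum p E (fun _ => c) = c := by
  induction E using Finset.induction_on with
  | empty => simp [bernoulliSum]
  | insert e E he ih =>
    rw [bernoulliSum_insert he, ← add_mul, add_sub_cancel, one_mul, ih]

theorem bernoulliSum_eq_empty : bernoulliSum p E (fun F : Finset α => if F = ∅ then 1 else 0) =
    (1 - p) ^ E.card := by
  simp [bernoulliSum]

/-- By `hf` the value of `f` ignores the state of `e`, so it is independent of the event that `e` is
present. -/
theorem bernoulliSum_mem_mul {e : α} (he : e ∈ E) (f : Finset α → ℝ)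
    (hf : ∀ F, f (insert e F) = f F) :
    bernoulliSum p E (fun F => (if e ∈ F then 1 else 0) * f F) = p * bernoulliSum p E f := by
  rw [← Finset.insert_erase he, bernoulliSum_insert (Finset.notMem_erase e E),
    bernoulliSum_insert (Finset.notMem_erase e E), mul_comm p, ← bernoulliSum_mul_right]
  refine bernoulliSum_congr fun F hF => ?_
  have : e ∉ F := fun h => Finset.notMem_erase e E (hF h)
  simp only [Finset.mem_insert_self, if_true, this, if_false, hf]
  ring

end BernoulliSum

/-! ### The edges of the complete graph on a finite set -/

/-- The edges of the complete graph on `T`. -/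
def edgesWithin {α : Type*} [DecidableEq α] (T : Finset α) : Finset (Sym2 α) :=
  T.sym2.filter fun e => ¬ e.IsDiag

/-- The edges between `S` and `T`. -/
def edgesBetween {α : Type*} [DecidableEq α] (S T : Finset α) : Finset (Sym2 α) :=
  (S ×ˢ T).image fun x => s(x.1, x.2)

section Edges

variable {α : Type*} [DecidableEq α] {S T : Finset α}

theorem mk_mem_edgesWithin {a b : α} : s(a, b) ∈ edgesWithin T ↔ (a ∈ T ∧ b ∈ T) ∧ a ≠ b := by
  simp [edgesWithin]

theorem mk_mem_edgesBetween {a b : α} :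
    s(a, b) ∈ edgesBetween S T ↔ (a ∈ S ∧ b ∈ T) ∨ (b ∈ S ∧ a ∈ T) := by
  simp only [edgesBetween, Finset.mem_image, Finset.mem_product, Prod.exists, Sym2.eq_iff]
  grind

theorem card_edgesWithin (T : Finset α) : (edgesWithin T).card = T.card.choose 2 := by
  rw [← Sym2.card_image_offDiag]
  congr 1
  ext e
  induction e with | _ a b =>
  rw [mk_mem_edgesWithin]
  simp only [Finset.mem_image, Finset.mem_offDiag, Prod.exists]
  constructor
  · exact fun h => ⟨a, b, ⟨h.1.1, h.1.2, h.2⟩, rfl⟩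
  · rintro ⟨x, y, h, hxy⟩
    change s(x, y) = s(a, b) at hxy
    rw [Sym2.eq_iff] at hxy
    grind

theorem card_edgesBetween (h : Disjoint S T) : (edgesBetween S T).card = S.card * T.card := by
  rw [edgesBetween, Finset.card_image_of_injOn, Finset.card_product]
  rintro ⟨a, b⟩ hab ⟨c, d⟩ hcd he
  simp only [Finset.coe_product, Set.mem_prod, Finset.mem_coe] at hab hcd
  simp only [Sym2.eq_iff] at he
  have := Finset.disjoint_left.1 h
  grind

theorem edgesWithin_eq_union (h : S ⊆ T) :
    edgesWithin T = edgesWithin S ∪ (edgesBetween S (T \ S) ∪ edgesWithin (T \ S)) := by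
  ext e
  induction e with | _ a b =>
  simp only [Finset.mem_union, mk_mem_edgesWithin, mk_mem_edgesBetween, Finset.mem_sdiff]
  have ha := @h a
  have hb := @h b
  grind

theorem disjoint_edgesWithin_union :
    Disjoint (edgesWithin S) (edgesBetween S (T \ S) ∪ edgesWithin (T \ S)) := by
  rw [Finset.disjoint_left]
  intro e
  induction e with | _ a b =>
  simp only [Finset.mem_union, mk_mem_edgesWithin, mk_mem_edgesBetween, Finset.mem_sdiff]
  grind

theorem disjoint_edgesBetween_edgesWithin :
    Disjoint (edgesBetween S (T \ S)) (edgesWithin (T \ S)) := by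
  rw [Finset.disjoint_left]
  intro e
  induction e with | _ a b =>
  simp only [mk_mem_edgesWithin, mk_mem_edgesBetween, Finset.mem_sdiff]
  grind

end Edges

/-! ### The vertex set of a cluster -/

/-- The vertices that can be reached from `v` along the edges in `F`. -/
def reachSet {α : Type*} (F : Set (Sym2 α)) (v : α) : Set α :=
  {w | (SimpleGraph.fromEdgeSet F).Reachable v w}

section ReachSet

variable {α : Type*} {F F' : Set (Sym2 α)} {v : α}

theorem self_mem_reachSet : v ∈ reachSet F v := SimpleGraph.Reachable.refl v

theorem reachSet_mono (h : F ⊆ F') : reachSet F v ⊆ reachSet F' v :=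
  fun _ hw => SimpleGraph.Reachable.mono (SimpleGraph.fromEdgeSet_mono h) hw

theorem mem_reachSet_of_mem {a b : α} (ha : a ∈ reachSet F v) (hab : s(a, b) ∈ F) :
    b ∈ reachSet F v := by
  by_cases h : a = b
  · exact h ▸ ha
  · exact SimpleGraph.Reachable.trans ha
      (SimpleGraph.Adj.reachable ((SimpleGraph.fromEdgeSet_adj F).2 ⟨hab, h⟩))

theorem reachSet_subset {S : Set α} (hv : v ∈ S) (h : ∀ a ∈ S, ∀ b, s(a, b) ∈ F → b ∈ S) :
    reachSet F v ⊆ S := by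
  intro w hw
  rw [reachSet, Set.mem_ofPred_eq, SimpleGraph.reachable_iff_reflTransGen] at hw
  induction hw with
  | refl => exact hv
  | tail _ hab ih => exact h _ ih _ ((SimpleGraph.fromEdgeSet_adj F).1 hab).1

end ReachSet

/-! ### The law of the cluster size and the expected number of cluster edges. -/

section Law

open scoped Classical

variable {α : Type*} [DecidableEq α] {p : ℝ} {v : α}

/-- An edge from `S` to its complement would enlarge the cluster, and without such edges the ones
outside `S` are never reached. The three conditions concern disjoint edge sets, so the probability
factors. -/
theorem reachSet_eq_iff {S T : Finset α} (hv : v ∈ S) {F₁ F₂ F₃ : Finset (Sym2 α)}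
    (h₁ : F₁ ⊆ edgesWithin S) (h₂ : F₂ ⊆ edgesBetween S (T \ S))
    (h₃ : F₃ ⊆ edgesWithin (T \ S)) :
    reachSet (↑(F₁ ∪ (F₂ ∪ F₃)) : Set (Sym2 α)) v = S ↔
      reachSet (F₁ : Set (Sym2 α)) v = S ∧ F₂ = ∅ := by
  constructor
  · intro h
    have h2 : F₂ = ∅ := by
      rw [Finset.eq_empty_iff_forall_notMem]
      intro e he
      induction e with | _ a b =>
      have key : ∀ a b, s(a, b) ∈ F₂ → a ∈ S → b ∈ T \ S → False := by
        intro a b hab ha hb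
        have : b ∈ reachSet (↑(F₁ ∪ (F₂ ∪ F₃)) : Set (Sym2 α)) v :=
          mem_reachSet_of_mem (a := a) (by rw [h]; exact ha) (by simp [hab])
        rw [h] at this
        exact (Finset.mem_sdiff.1 hb).2 this
      rcases mk_mem_edgesBetween.1 (h₂ he) with h' | h'
      · exact key a b he h'.1 h'.2
      · exact key b a (Sym2.eq_swap ▸ he) h'.1 h'.2
    refine ⟨?_, h2⟩
    refine Set.Subset.antisymm ((reachSet_mono (by simp)).trans h.subset) ?_
    rw [← h]
    have : reachSet (↑(F₁ ∪ (F₂ ∪ F₃)) : Set (Sym2 α)) v ⊆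
        reachSet (F₁ : Set (Sym2 α)) v ∩ S := by
      refine reachSet_subset ⟨self_mem_reachSet, hv⟩ ?_
      rintro a ⟨ha, haS⟩ b hab
      have haS' : a ∈ S := haS
      simp only [h2, Finset.coe_union, Set.mem_union, Finset.mem_coe, Finset.notMem_empty,
        false_or] at hab
      rcases hab with hab | hab
      · exact ⟨mem_reachSet_of_mem ha hab, (mk_mem_edgesWithin.1 (h₁ hab)).1.2⟩
      · have := (mk_mem_edgesWithin.1 (h₃ hab)).1.1
        exact absurd haS' (Finset.mem_sdiff.1 this).2
    exact this.trans Set.inter_subset_left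
  · rintro ⟨h, h2⟩
    refine Set.Subset.antisymm ?_ (h.symm.subset.trans (reachSet_mono (by simp)))
    refine reachSet_subset hv fun a ha b hab => ?_
    have haS' : a ∈ S := ha
    simp only [h2, Finset.coe_union, Set.mem_union, Finset.mem_coe, Finset.notMem_empty,
      false_or] at hab
    rcases hab with hab | hab
    · exact (mk_mem_edgesWithin.1 (h₁ hab)).1.2
    · have := (mk_mem_edgesWithin.1 (h₃ hab)).1.1
      exact absurd haS' (Finset.mem_sdiff.1 this).2

/-- The probability that the random graph on `S` is connected (for `v ∈ S`). -/
noncomputable def connectProb (p : ℝ) (v : α) (S : Finset α) : ℝ :=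
  bernoulliSum p (edgesWithin S) fun F => if reachSet (F : Set (Sym2 α)) v = S then 1 else 0

theorem connectProb_nonneg (hp0 : 0 ≤ p) (hp1 : p ≤ 1) (S : Finset α) : 0 ≤ connectProb p v S :=
  bernoulliSum_nonneg hp0 hp1 fun F => by split_ifs <;> norm_num

theorem bernoulliSum_reachSet_eq {S T : Finset α} (hv : v ∈ S) (hST : S ⊆ T) :
    bernoulliSum p (edgesWithin T)
        (fun F => if reachSet (F : Set (Sym2 α)) v = S then 1 else 0) =
      connectProb p v S * (1 - p) ^ (S.card * (T \ S).card) := by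
  rw [edgesWithin_eq_union hST, bernoulliSum_union disjoint_edgesWithin_union,
    ← card_edgesBetween Finset.disjoint_sdiff, ← bernoulliSum_eq_empty, connectProb,
    ← bernoulliSum_mul_right]
  refine bernoulliSum_congr fun F₁ h₁ => ?_
  rw [bernoulliSum_union disjoint_edgesBetween_edgesWithin, mul_comm, ← bernoulliSum_mul_right]
  refine bernoulliSum_congr fun F₂ h₂ => ?_
  rw [← bernoulliSum_const (p := p) (E := edgesWithin (T \ S)) (_ * _)]
  refine bernoulliSum_congr fun F₃ h₃ => ?_
  rw [ite_zero_mul_ite_zero, one_mul]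
  exact if_congr ((reachSet_eq_iff hv h₁ h₂ h₃).trans and_comm) rfl rfl

theorem exists_reachSet_eq {U : Finset α} (hv : v ∉ U) {F : Finset (Sym2 α)}
    (hF : F ⊆ edgesWithin (insert v U)) :
    ∃ A ⊆ U, reachSet (F : Set (Sym2 α)) v = ↑(insert v A) := by
  have h : reachSet (F : Set (Sym2 α)) v ⊆ ↑(insert v U) := by
    refine reachSet_subset (by simp) fun a _ b hab => ?_
    exact (mk_mem_edgesWithin.1 (hF hab)).1.2
  refine ⟨U.filter (· ∈ reachSet (F : Set (Sym2 α)) v), Finset.filter_subset _ _, ?_⟩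
  ext x
  simp only [Finset.coe_insert, Finset.coe_filter, Set.mem_insert_iff, Set.mem_ofPred_eq]
  constructor
  · intro hx
    have := h hx
    simp only [Finset.coe_insert, Set.mem_insert_iff, Finset.mem_coe] at this
    tauto
  · rintro (rfl | hx)
    · exact self_mem_reachSet
    · exact hx.2

theorem bernoulliSum_card_reachSet_eq_sum_powerset {U : Finset α} (hv : v ∉ U) (h : ℕ → ℝ) :
    bernoulliSum p (edgesWithin (insert v U))
        (fun F => h (reachSet (F : Set (Sym2 α)) v).ncard) =
      ∑ A ∈ U.powerset, connectProb p v (insert v A) *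
        (1 - p) ^ ((A.card + 1) * (U.card - A.card)) * h (A.card + 1) := by
  have h1 : ∀ A ∈ U.powerset, connectProb p v (insert v A) *
        (1 - p) ^ ((A.card + 1) * (U.card - A.card)) * h (A.card + 1) =
      bernoulliSum p (edgesWithin (insert v U)) (fun F =>
        (if reachSet (F : Set (Sym2 α)) v = ↑(insert v A) then 1 else 0) * h (A.card + 1)) := by
    intro A hA
    have hA' := Finset.mem_powerset.1 hA
    have hvA : v ∉ A := fun h => hv (hA' h)
    rw [bernoulliSum_mul_right, bernoulliSum_reachSet_eq (Finset.mem_insert_self v A)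
      (Finset.insert_subset_insert v hA'), Finset.card_insert_of_notMem hvA,
      Finset.card_sdiff_of_subset (Finset.insert_subset_insert v hA'),
      Finset.card_insert_of_notMem hvA, Finset.card_insert_of_notMem hv, Nat.add_sub_add_right]
  rw [Finset.sum_congr rfl h1, ← bernoulliSum_sum]
  refine bernoulliSum_congr fun F hF => ?_
  obtain ⟨A, hA, hFA⟩ := exists_reachSet_eq hv hF
  have hvA : v ∉ A := fun h => hv (hA h)
  rw [Finset.sum_eq_single A]
  · rw [if_pos hFA, hFA, Set.ncard_coe_finset, Finset.card_insert_of_notMem hvA, one_mul]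
  · intro B hB hBA
    have hvB : v ∉ B := fun h => hv (Finset.mem_powerset.1 hB h)
    rw [if_neg, zero_mul]
    rw [hFA, Finset.coe_inj]
    intro h
    apply hBA
    rw [← Finset.erase_insert hvA, ← Finset.erase_insert hvB, h]
  · intro h
    exact absurd (Finset.mem_powerset.2 hA) h

/-- The probability that the random graph on `N + 1` vertices is connected, defined by its
recursion. -/
noncomputable def connectCoeff (p : ℝ) (N : ℕ) : ℝ :=
  1 - ∑ i : Fin N, (N.choose i : ℝ) * connectCoeff p i * (1 - p) ^ ((i + 1 : ℕ) * (N - i))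
termination_by N

theorem sum_connectCoeff (p : ℝ) (N : ℕ) :
    ∑ i ∈ Finset.range (N + 1),
      (N.choose i : ℝ) * connectCoeff p i * (1 - p) ^ ((i + 1) * (N - i)) = 1 := by
  rw [Finset.sum_range_succ, connectCoeff.eq_def p N, ← Fin.sum_univ_eq_sum_range
    (fun i => (N.choose i : ℝ) * connectCoeff p i * (1 - p) ^ ((i + 1) * (N - i)))]
  simp

/-- The cluster size probabilities sum to one, and this determines the connection probability of `U`
from those of its proper subsets. Both sides satisfy this recursion, which also shows that only the
cardinality matters. -/
theorem connectProb_insert (p : ℝ) (v : α) (U : Finset α) (hv : v ∉ U) :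
    connectProb p v (insert v U) = connectCoeff p U.card := by
  induction U using Finset.strongInduction with | _ U ih =>
  have h1 := bernoulliSum_card_reachSet_eq_sum_powerset (p := p) hv (fun _ => 1)
  rw [bernoulliSum_const, ← Finset.insert_erase (Finset.mem_powerset_self U),
    Finset.sum_insert (Finset.notMem_erase _ _)] at h1
  have h2 := sum_connectCoeff p U.card
  have h3 := Finset.sum_powerset_apply_card (x := U) (fun i => connectCoeff p i *
    (1 - p) ^ ((i + 1) * (U.card - i)))
  simp only [nsmul_eq_mul, ← mul_assoc, h2] at h3
  rw [← Finset.insert_erase (Finset.mem_powerset_self U),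
    Finset.sum_insert (Finset.notMem_erase _ _)] at h3
  have h4 : ∀ A ∈ U.powerset.erase U, connectProb p v (insert v A) *
      (1 - p) ^ ((A.card + 1) * (U.card - A.card)) * 1 =
      connectCoeff p A.card * (1 - p) ^ ((A.card + 1) * (U.card - A.card)) := by
    intro A hA
    rw [Finset.mem_erase, Finset.mem_powerset] at hA
    rw [ih A (Finset.ssubset_iff_subset_ne.2 ⟨hA.2, hA.1⟩) fun h => hv (hA.2 h), mul_one]
  rw [Finset.sum_congr rfl h4] at h1
  simp only [Nat.sub_self, mul_zero, pow_zero, mul_one] at h1 h3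
  linarith

theorem connectCoeff_nonneg (hp0 : 0 ≤ p) (hp1 : p ≤ 1) (N : ℕ) : 0 ≤ connectCoeff p N := by
  have h := connectProb_insert p N (Finset.range N) Finset.notMem_range_self
  rw [Finset.card_range] at h
  exact h ▸ connectProb_nonneg hp0 hp1 _

/-- The expectation of `h |𝒞(v)|` in the random graph on `N + 1` vertices. -/
noncomputable def clusterMean (p : ℝ) (N : ℕ) (h : ℕ → ℝ) : ℝ :=
  ∑ i ∈ Finset.range (N + 1),
    (N.choose i : ℝ) * connectCoeff p i * (1 - p) ^ ((i + 1) * (N - i)) * h (i + 1)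

theorem bernoulliSum_card_reachSet {U : Finset α} (hv : v ∉ U) (h : ℕ → ℝ) :
    bernoulliSum p (edgesWithin (insert v U))
        (fun F => h (reachSet (F : Set (Sym2 α)) v).ncard) = clusterMean p U.card h := by
  rw [bernoulliSum_card_reachSet_eq_sum_powerset hv, clusterMean]
  have h3 := Finset.sum_powerset_apply_card (x := U) (fun i => connectCoeff p i *
    (1 - p) ^ ((i + 1) * (U.card - i)) * h (i + 1))
  simp only [nsmul_eq_mul, ← mul_assoc] at h3
  rw [← h3]
  refine Finset.sum_congr rfl fun A hA => ?_
  rw [connectProb_insert p v A fun h => hv (Finset.mem_powerset.1 hA h)]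

/-- The number of edges of the cluster of `v` has expectation `p` times the expected number of pairs
that meet the cluster. -/
theorem bernoulliSum_card_edges {U : Finset α} (hv : v ∉ U) :
    bernoulliSum p (edgesWithin (insert v U))
        (fun F => ({e ∈ (F : Set (Sym2 α)) | ∃ a ∈ e, a ∈ reachSet (F : Set (Sym2 α)) v}.ncard : ℝ)) =
      p * clusterMean p U.card
        (fun k => ((U.card + 1).choose 2 : ℝ) - ((U.card + 1 - k).choose 2 : ℝ)) := by
  -- If `e` does not meet the cluster, adding it leaves the cluster unchanged; hence meeting the
  -- cluster is independent of the state of `e`.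
  have key : ∀ (e : Sym2 α) (F : Finset (Sym2 α)),
      (∃ a ∈ e, a ∈ reachSet (↑(insert e F) : Set (Sym2 α)) v) ↔
        ∃ a ∈ e, a ∈ reachSet (F : Set (Sym2 α)) v := by
    intro e F
    constructor
    · intro h
      by_contra! h'
      obtain ⟨a, hae, ha⟩ := h
      refine h' a hae (reachSet_subset self_mem_reachSet (fun x hx y hxy => ?_) ha)
      rw [Finset.coe_insert, Set.mem_insert_iff] at hxy
      rcases hxy with rfl | hxy
      · exact absurd hx (h' x (by simp))
      · exact mem_reachSet_of_mem hx hxy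
    · rintro ⟨a, hae, ha⟩
      exact ⟨a, hae, reachSet_mono (by simp) ha⟩
  rw [← bernoulliSum_card_reachSet hv]
  have h1 : bernoulliSum p (edgesWithin (insert v U))
        (fun F => ({e ∈ (F : Set (Sym2 α)) | ∃ a ∈ e, a ∈ reachSet (F : Set (Sym2 α)) v}.ncard : ℝ)) =
      bernoulliSum p (edgesWithin (insert v U)) (fun F => ∑ e ∈ edgesWithin (insert v U),
        (if e ∈ F then 1 else 0) *
          (if ∃ a ∈ e, a ∈ reachSet (F : Set (Sym2 α)) v then 1 else 0)) := by
    refine bernoulliSum_congr fun F hF => ?_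
    simp only [ite_zero_mul_ite_zero, one_mul]
    rw [← Finset.sum_filter, Finset.sum_const, nsmul_one, ← Set.ncard_coe_finset]
    congr 2
    ext e
    simp only [Finset.coe_filter, Set.mem_ofPred_eq, Finset.mem_coe]
    exact ⟨fun h => ⟨hF h.1, h⟩, fun h => h.2⟩
  rw [h1, bernoulliSum_sum, Finset.sum_congr rfl fun e he =>
    bernoulliSum_mem_mul he _ fun F => by simp only [key], ← Finset.mul_sum, ← bernoulliSum_sum]
  congr 1
  refine bernoulliSum_congr fun F hF => ?_
  obtain ⟨A, hA, hFA⟩ := exists_reachSet_eq hv hF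
  have hvA : v ∉ A := fun h => hv (hA h)
  rw [hFA, ← Finset.sum_filter, Finset.sum_const, nsmul_one, Set.ncard_coe_finset, eq_sub_iff_add_eq]
  have h2 : (insert v U).card - (insert v A).card = (insert v U \ insert v A).card :=
    (Finset.card_sdiff_of_subset (Finset.insert_subset_insert v hA)).symm
  rw [← Finset.card_insert_of_notMem hv, h2, ← card_edgesWithin, ← card_edgesWithin]
  norm_cast
  rw [← Finset.card_union_of_disjoint]
  · congr 1
    ext e
    induction e with | _ a b =>
    simp only [Finset.mem_union, Finset.mem_filter, mk_mem_edgesWithin, Finset.mem_sdiff,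
      Sym2.mem_iff]
    grind
  · rw [Finset.disjoint_left]
    intro e
    induction e with | _ a b =>
    simp only [Finset.mem_filter, mk_mem_edgesWithin, Finset.mem_sdiff,
      Sym2.mem_iff]
    grind

end Law

/-! ### From integrals over random graphs to the finite sums `clusterMean`. -/

section Transfer

open scoped Classical

theorem integral_binomialRandom {V : Type*} [Fintype V] [DecidableEq V] (p : unitInterval)
    (f : SimpleGraph V → ℝ) :
    ∫ G, f G ∂(SimpleGraph.binomialRandom V p) =
      bernoulliSum (p : ℝ) (edgesWithin (Finset.univ : Finset V))
        fun F => f (SimpleGraph.fromEdgeSet F) := by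
  have : MeasurableSingletonClass (SimpleGraph V) := ⟨fun G => by
    rw [← Set.preimage_image_eq {G} SimpleGraph.edgeSet_injective, Set.image_singleton]
    exact SimpleGraph.measurable_edgeSet (measurableSet_singleton _)⟩
  rw [integral_fintype (Integrable.of_finite), bernoulliSum]
  have hE : ∀ G : SimpleGraph V, G.edgeFinset ⊆ edgesWithin (Finset.univ : Finset V) := by
    intro G e
    induction e with | _ a b =>
    intro h
    rw [SimpleGraph.mem_edgeFinset, SimpleGraph.mem_edgeSet] at h
    exact mk_mem_edgesWithin.2 ⟨⟨Finset.mem_univ _, Finset.mem_univ _⟩, h.ne⟩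
  refine Finset.sum_bij' (fun G _ => G.edgeFinset) (fun F _ => SimpleGraph.fromEdgeSet (F : Set _))
    ?_ ?_ ?_ ?_ ?_
  · exact fun G _ => Finset.mem_powerset.2 (hE G)
  · exact fun F _ => Finset.mem_univ _
  · intro G _
    simp
  · intro F hF
    ext e
    have : e ∈ F → e ∈ edgesWithin Finset.univ := fun h => Finset.mem_powerset.1 hF h
    obtain ⟨G, hG⟩ : ∃ G, G = SimpleGraph.fromEdgeSet (F : Set (Sym2 V)) := ⟨_, rfl⟩
    rw [← hG, SimpleGraph.mem_edgeFinset, hG, SimpleGraph.edgeSet_fromEdgeSet]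
    simp only [edgesWithin, Finset.mem_filter] at this
    simp only [Set.mem_sdiff, Finset.mem_coe]
    exact ⟨fun h => h.1, fun h => ⟨h, (this h).2⟩⟩
  · intro G _
    have h1 : (edgesWithin (Finset.univ : Finset V) \ G.edgeFinset).card =
        (Nat.card V).choose 2 - G.edgeSet.ncard := by
      rw [Finset.card_sdiff_of_subset (hE G), card_edgesWithin, Nat.card_eq_fintype_card,
        Finset.card_univ, Set.ncard_eq_toFinset_card']
      rfl
    have h2 : G.edgeFinset.card = G.edgeSet.ncard := by
      rw [Set.ncard_eq_toFinset_card']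
      rfl
    rw [measureReal_def, SimpleGraph.binomialRandom_singleton, h1, h2]
    simp [ENNReal.toReal_mul]

theorem clusterSize_fromEdgeSet {V : Type*} (F : Set (Sym2 V)) (v : V) :
    clusterSize (SimpleGraph.fromEdgeSet F) v = (reachSet F v).ncard := by
  rw [clusterSize, reachSet, Nat.card_coe_set_eq]

/-- An edge with one endpoint in the cluster has both there. This turns the induced edge set into
the set counted by `bernoulliSum_card_edges`. -/
theorem natCard_edgeSet_cluster {V : Type*} (F : Finset (Sym2 V)) (hF : ∀ e ∈ F, ¬ e.IsDiag)
    (v : V) : Nat.card (cluster (SimpleGraph.fromEdgeSet (F : Set (Sym2 V))) v).edgeSet =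
      {e ∈ (F : Set (Sym2 V)) | ∃ a ∈ e, a ∈ reachSet (F : Set (Sym2 V)) v}.ncard := by
  rw [Nat.card_coe_set_eq, ← Set.ncard_image_of_injective _
    (Sym2.map.injective Subtype.val_injective)]
  congr 1
  ext e
  induction e with | _ a b =>
  simp only [Set.mem_image, Set.mem_ofPred_eq]
  constructor
  · rintro ⟨e', he', h⟩
    induction e' with | _ x y =>
    rw [SimpleGraph.mem_edgeSet] at he'
    have h1 : s(x.1, y.1) ∈ (F : Set (Sym2 V)) := ((SimpleGraph.fromEdgeSet_adj _).1 he').1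
    rw [← h]
    exact ⟨h1, x.1, by simp, x.2⟩
  · rintro ⟨h, c, hc, hcr⟩
    have hab : a ≠ b := fun hab => hF _ h (by simpa using hab)
    have hmem : a ∈ reachSet (F : Set (Sym2 V)) v ∧ b ∈ reachSet (F : Set (Sym2 V)) v := by
      rcases Sym2.mem_iff.1 hc with rfl | rfl
      · exact ⟨hcr, mem_reachSet_of_mem hcr h⟩
      · exact ⟨mem_reachSet_of_mem hcr (Sym2.eq_swap ▸ h), hcr⟩
    refine ⟨s(⟨a, hmem.1⟩, ⟨b, hmem.2⟩), ?_, rfl⟩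
    rw [SimpleGraph.mem_edgeSet]
    exact (SimpleGraph.fromEdgeSet_adj _).2 ⟨h, hab⟩

theorem integral_clusterSize {N : ℕ} (p : unitInterval) (v : Fin (N + 1)) (h : ℕ → ℝ) :
    ∫ G, h (clusterSize G v) ∂(SimpleGraph.binomialRandom (Fin (N + 1)) p) =
      clusterMean p N h := by
  rw [integral_binomialRandom]
  simp only [clusterSize_fromEdgeSet]
  rw [← Finset.insert_erase (Finset.mem_univ v),
    bernoulliSum_card_reachSet (Finset.notMem_erase _ _)]
  simp

theorem clusterMean_add (p : ℝ) (N : ℕ) (f g : ℕ → ℝ) :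
    clusterMean p N (fun k => f k + g k) = clusterMean p N f + clusterMean p N g := by
  simp only [clusterMean, mul_add, Finset.sum_add_distrib]

theorem clusterMean_mul_left (p : ℝ) (N : ℕ) (c : ℝ) (f : ℕ → ℝ) :
    clusterMean p N (fun k => c * f k) = c * clusterMean p N f := by
  simp only [clusterMean, Finset.mul_sum]
  exact Finset.sum_congr rfl fun i _ => by ring

theorem clusterMean_const (p : ℝ) (N : ℕ) (c : ℝ) : clusterMean p N (fun _ => c) = c := by
  simp only [clusterMean, ← Finset.sum_mul, sum_connectCoeff, one_mul]

theorem clusterMean_congr {p : ℝ} {N : ℕ} {f g : ℕ → ℝ}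
    (h : ∀ k, 1 ≤ k → k ≤ N + 1 → f k = g k) : clusterMean p N f = clusterMean p N g := by
  refine Finset.sum_congr rfl fun i hi => ?_
  rw [h (i + 1) (by omega) (by have := Finset.mem_range.1 hi; omega)]

theorem clusterMean_mono {p : ℝ} (hp0 : 0 ≤ p) (hp1 : p ≤ 1) {N : ℕ} {f g : ℕ → ℝ}
    (h : ∀ k, 1 ≤ k → k ≤ N + 1 → f k ≤ g k) : clusterMean p N f ≤ clusterMean p N g := by
  have h1 := sub_nonneg.2 hp1
  refine Finset.sum_le_sum fun i hi => ?_
  have h2 := connectCoeff_nonneg hp0 hp1 i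
  exact mul_le_mul_of_nonneg_left
    (h (i + 1) (by omega) (by have := Finset.mem_range.1 hi; omega)) (by positivity)

theorem integral_surplus {N : ℕ} (p : unitInterval) (v : Fin (N + 1)) :
    ∫ G, (surplus (cluster G v) : ℝ) ∂(SimpleGraph.binomialRandom (Fin (N + 1)) p) =
      clusterMean p N fun k => (p : ℝ) * (((N : ℝ) + 1) * k - (k : ℝ) ^ 2 / 2 - k / 2) - k + 1 := by
  rw [integral_binomialRandom]
  have h1 : ∀ F ⊆ edgesWithin (Finset.univ : Finset (Fin (N + 1))),
      (surplus (cluster (SimpleGraph.fromEdgeSet (F : Set (Sym2 (Fin (N + 1))))) v) : ℝ) =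
      ({e ∈ (F : Set (Sym2 (Fin (N + 1)))) |
        ∃ a ∈ e, a ∈ reachSet (F : Set (Sym2 (Fin (N + 1)))) v}.ncard : ℝ) +
        (-((reachSet (F : Set (Sym2 (Fin (N + 1)))) v).ncard : ℝ) + 1) := by
    intro F hF
    have h2 : Nat.card {w | (SimpleGraph.fromEdgeSet (F : Set (Sym2 (Fin (N + 1))))).Reachable v w}
        = (reachSet (F : Set (Sym2 (Fin (N + 1)))) v).ncard := by
      rw [reachSet, Nat.card_coe_set_eq]
    rw [surplus, natCard_edgeSet_cluster F (fun e he => (Finset.mem_filter.1 (hF he)).2), h2]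
    push_cast
    ring
  rw [bernoulliSum_congr h1, bernoulliSum_add, ← Finset.insert_erase (Finset.mem_univ v),
    bernoulliSum_card_reachSet (Finset.notMem_erase _ _) (fun k => -(k : ℝ) + 1),
    bernoulliSum_card_edges (Finset.notMem_erase _ _), ← clusterMean_mul_left, ← clusterMean_add]
  simp only [Finset.card_erase_of_mem, Finset.mem_univ, Finset.card_univ, Fintype.card_fin,
    Nat.add_sub_cancel]
  refine clusterMean_congr fun k hk1 hk => ?_
  rw [Nat.cast_choose_two, Nat.cast_choose_two, Nat.cast_sub hk]
  push_cast
  ring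

end Transfer

/-! ### Comparison of the laws for different numbers of vertices. -/

section Identities

variable {p : ℝ}

/-- Removing a vertex outside of the cluster: the law of the cluster on `N + 1` vertices is
obtained from the law on `N + 2` vertices. -/
theorem clusterMean_succ (hp1 : p < 1) (N : ℕ) (h : ℕ → ℝ) :
    clusterMean p (N + 1) (fun k => (1 - ((k : ℝ) - 1) / (N + 1)) * ((1 - p)⁻¹ ^ k * h k)) =
      clusterMean p N h := by
  have hq : (1 - p) ≠ 0 := (sub_pos.2 hp1).ne'
  have hN : (N : ℝ) + 1 ≠ 0 := by positivity
  rw [clusterMean, Finset.sum_range_succ, clusterMean]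
  -- The cluster containing all `N + 2` vertices leaves none to remove: its weight vanishes, so both
  -- sums have the same range.
  have h0 : (1 : ℝ) - (((N + 1 + 1 : ℕ) : ℝ) - 1) / (N + 1) = 0 := by
    push_cast; field_simp; ring
  rw [h0, zero_mul, mul_zero, add_zero]
  refine Finset.sum_congr rfl fun i hi => ?_
  have hi' : i ≤ N := Nat.lt_succ_iff.1 (Finset.mem_range.1 hi)
  have h1 : ((N + 1).choose i : ℝ) * (1 - (((i + 1 : ℕ) : ℝ) - 1) / (N + 1)) = N.choose i := by
    have h2 := congrArg (Nat.cast (R := ℝ)) (Nat.choose_mul_succ_eq N i)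
    push_cast [Nat.cast_sub (Nat.le_succ_of_le hi')] at h2
    push_cast
    field_simp
    linear_combination -h2
  have h3 : (1 - p) ^ ((i + 1) * (N + 1 - i)) * (1 - p)⁻¹ ^ (i + 1) =
      (1 - p) ^ ((i + 1) * (N - i)) := by
    rw [Nat.succ_sub hi', Nat.mul_succ, pow_add, inv_pow, mul_assoc,
      mul_inv_cancel₀ (pow_ne_zero _ hq), mul_one]
  rw [← h1, ← h3]
  ring

/-- Factor by factor: `(N - s) / N ≤ (N + j - s) / (N + j)` for each `s < i`. -/
theorem choose_mul_pow_le (N j i : ℕ) (hi : i ≤ N) :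
    N.choose i * (N + j) ^ i ≤ (N + j).choose i * N ^ i := by
  have key : ∀ i ≤ N, N.descFactorial i * (N + j) ^ i ≤ (N + j).descFactorial i * N ^ i := by
    intro i
    induction i with
    | zero => simp
    | succ i ih =>
      intro hi
      rw [Nat.descFactorial_succ, Nat.descFactorial_succ, pow_succ, pow_succ]
      have h1 : (N - i) * (N + j) ≤ (N + j - i) * N := by
        obtain ⟨d, rfl⟩ := Nat.exists_eq_add_of_lt hi
        rw [show i + d + 1 - i = d + 1 by omega, show i + d + 1 + j - i = d + 1 + j by omega]
        nlinarith [Nat.zero_le (i * j)]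
      calc _ = ((N - i) * (N + j)) * (N.descFactorial i * (N + j) ^ i) := by ring
        _ ≤ ((N + j - i) * N) * ((N + j).descFactorial i * N ^ i) :=
          Nat.mul_le_mul h1 (ih (by omega))
        _ = _ := by ring
  have h := key i hi
  rw [Nat.descFactorial_eq_factorial_mul_choose, Nat.descFactorial_eq_factorial_mul_choose,
    mul_assoc, mul_assoc] at h
  exact Nat.le_of_mul_le_mul_left h i.factorial_pos

/-- Adding `j` vertices: the total mass on `N + 1 + j` vertices of the small clusters is at
most one. -/
theorem clusterMean_pow_le_one (hp0 : 0 ≤ p) (hp1 : p ≤ 1) {N : ℕ} (hN : 0 < N) (j : ℕ) :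
    clusterMean p N (fun k => (1 + (j : ℝ) / N) ^ (k - 1) * ((1 - p) ^ j) ^ k) ≤ 1 := by
  have hq := sub_nonneg.2 hp1
  have hN' : (0 : ℝ) < N := by exact_mod_cast hN
  refine le_of_le_of_eq ?_ (sum_connectCoeff p (N + j))
  rw [clusterMean]
  -- Each term is at most the probability of the same cluster size on `N + j + 1` vertices; the
  -- sizes above `N + 1` are dropped.
  refine (Finset.sum_le_sum (g := fun i => ((N + j).choose i : ℝ) * connectCoeff p i *
    (1 - p) ^ ((i + 1) * (N + j - i))) fun i hi => ?_).trans
    (Finset.sum_le_sum_of_subset_of_nonneg (Finset.range_mono (by omega)) fun i _ _ => ?_)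
  · have hi' : i ≤ N := Nat.lt_succ_iff.1 (Finset.mem_range.1 hi)
    have hc := connectCoeff_nonneg hp0 hp1 i
    have h1 : (N.choose i : ℝ) * (1 + (j : ℝ) / N) ^ i ≤ (N + j).choose i := by
      have h2 : (N.choose i : ℝ) * (N + j) ^ i ≤ (N + j).choose i * N ^ i := by
        exact_mod_cast choose_mul_pow_le N j i hi'
      rw [one_add_div hN'.ne', div_pow, ← mul_div_assoc, div_le_iff₀ (by positivity)]
      exact h2
    have h3 : (1 - p) ^ ((i + 1) * (N - i)) * ((1 - p) ^ j) ^ (i + 1) =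
        (1 - p) ^ ((i + 1) * (N + j - i)) := by
      rw [← pow_mul, ← pow_add]
      congr 1
      rw [show N + j - i = N - i + j by omega]
      ring
    rw [← h3, Nat.add_sub_cancel]
    calc _ = ((N.choose i : ℝ) * (1 + (j : ℝ) / N) ^ i) * (connectCoeff p i *
          ((1 - p) ^ ((i + 1) * (N - i)) * ((1 - p) ^ j) ^ (i + 1))) := by ring
      _ ≤ ((N + j).choose i : ℝ) * (connectCoeff p i *
          ((1 - p) ^ ((i + 1) * (N - i)) * ((1 - p) ^ j) ^ (i + 1))) :=
        mul_le_mul_of_nonneg_right h1 (by positivity)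
      _ = _ := by ring
  · have hc := connectCoeff_nonneg hp0 hp1 i
    positivity

end Identities

/-! ### A uniform bound on the third moment. -/

section Moments

theorem exists_clusterMean_cube_le {lam : ℝ} (h0 : 0 < lam) (h1 : lam < 1) :
    ∃ M : ℝ, 0 ≤ M ∧ ∀ N : ℕ, 0 < N →
      clusterMean (lam / N) N (fun k => (k : ℝ) ^ 3) ≤ M := by
  -- With `ε = j / N` between `ε₀ / 2` and `ε₀`, one has `(1 + ε) * (1 - lam * ε) ≥ 1 + ε * (1 -
  -- lam) / 2 ≥ b`, so the exponential moment has a base `b > 1` that is independent of `N`.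
  set ε₀ : ℝ := (1 - lam) / 2 with hε₀
  have hε₀pos : 0 < ε₀ := by rw [hε₀]; linarith
  set b : ℝ := 1 + (1 - lam) ^ 2 / 8 with hb
  have hb1 : 1 < b := by
    rw [hb]
    have : 0 < (1 - lam) ^ 2 := pow_pos (by linarith) 2
    linarith
  have hlog : 0 < Real.log b := Real.log_pos hb1
  refine ⟨6 / Real.log b ^ 3 * 2 + (1 / ε₀ + 1) ^ 3, by positivity, fun N hN => ?_⟩
  have hN' : (1 : ℝ) ≤ N := by exact_mod_cast hN
  have hp0 : 0 ≤ lam / N := by positivity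
  have hp1 : lam / N ≤ 1 := (div_le_one (by linarith)).2 (by linarith)
  -- For small `N` the floor defining `j` would be zero; there the trivial bound `k ≤ N + 1`
  -- suffices.
  by_cases hs : (N : ℝ) < 1 / ε₀
  · refine (clusterMean_mono hp0 hp1 (g := fun _ => (1 / ε₀ + 1) ^ 3) fun k _ hk => ?_).trans ?_
    · have : (k : ℝ) ≤ N + 1 := by exact_mod_cast hk
      exact pow_le_pow_left₀ (by positivity) (by linarith) 3
    · rw [clusterMean_const]
      have : 0 ≤ 6 / Real.log b ^ 3 * 2 := by positivity
      linarith
  · have hs' : 1 ≤ ε₀ * N := by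
      have := (div_le_iff₀ hε₀pos).1 (not_lt.1 hs)
      linarith
    set j := ⌊ε₀ * N⌋₊ with hj
    have hj1 : (j : ℝ) ≤ ε₀ * N := Nat.floor_le (by positivity)
    have hj2 : ε₀ * N / 2 ≤ j := by
      have h2 := Nat.lt_floor_add_one (ε₀ * N)
      have h3 : (1 : ℝ) ≤ j := by exact_mod_cast (Nat.one_le_floor_iff _).2 hs'
      rw [← hj] at h2
      linarith
    set ε : ℝ := (j : ℝ) / N with hε
    have he1 : ε ≤ ε₀ := (div_le_iff₀ (by linarith)).2 hj1
    have he2 : ε₀ / 2 ≤ ε := (le_div_iff₀ (by linarith)).2 (by linarith)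
    have hB : 1 - lam * ε ≤ (1 - lam / N) ^ j := by
      have h2 := one_add_mul_le_pow (a := -(lam / N)) (by linarith) j
      calc 1 - lam * ε = 1 + j * (-(lam / N)) := by rw [hε]; ring
        _ ≤ (1 + -(lam / N)) ^ j := h2
        _ = _ := by rw [← sub_eq_add_neg]
    have hbb : b ≤ (1 + ε) * (1 - lam / N) ^ j := by
      refine le_trans ?_ (mul_le_mul_of_nonneg_left hB (by linarith))
      have h2 : lam * ε ≤ (1 - lam) / 2 := by nlinarith
      have h3 : ε * ((1 - lam) / 2) ≤ ε * (1 - lam - lam * ε) :=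
        mul_le_mul_of_nonneg_left (by linarith) (by linarith)
      have h4 : ε₀ / 2 * ((1 - lam) / 2) ≤ ε * ((1 - lam) / 2) :=
        mul_le_mul_of_nonneg_right he2 (by linarith)
      rw [hb]
      rw [hε₀] at h4
      nlinarith
    have hexp := clusterMean_pow_le_one hp0 hp1 hN j
    have h5 : clusterMean (lam / N) N (fun k => (k : ℝ) ^ 3) ≤
        clusterMean (lam / N) N (fun k => (6 / Real.log b ^ 3 * 2) *
          ((1 + ε) ^ (k - 1) * ((1 - lam / N) ^ j) ^ k)) := by
      refine clusterMean_mono hp0 hp1 fun k hk _ => ?_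
      have h6 : (Real.log b * k) ^ 3 / (Nat.factorial 3 : ℕ) ≤ Real.exp (Real.log b * k) :=
        Real.pow_div_factorial_le_exp _ (by positivity) 3
      rw [mul_comm (Real.log b), Real.exp_nat_mul, Real.exp_log (by linarith)] at h6
      -- The `2` absorbs one factor `1 + ε`, because the exponent available is `k - 1` and not `k`.
      have h7 : b ^ k ≤ 2 * ((1 + ε) ^ (k - 1) * ((1 - lam / N) ^ j) ^ k) := by
        refine (pow_le_pow_left₀ (by linarith) hbb k).trans ?_
        obtain ⟨l, rfl⟩ := Nat.exists_eq_add_of_le' hk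
        rw [mul_pow, pow_succ (1 + ε), Nat.add_sub_cancel]
        have h8 : 1 + ε ≤ 2 := by linarith
        have h9 : 0 ≤ (1 + ε) ^ l * ((1 - lam / N) ^ j) ^ (l + 1) := by
          have : 0 ≤ 1 - lam / N := by linarith
          have : 0 ≤ 1 + ε := by linarith
          positivity
        nlinarith
      have h10 := h6.trans h7
      rw [mul_pow, div_le_iff₀ (by positivity)] at h10
      norm_num [Nat.factorial] at h10
      rw [div_mul_eq_mul_div, div_mul_eq_mul_div, le_div_iff₀ (by positivity)]
      linarith
    rw [clusterMean_mul_left] at h5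
    have h11 : 0 ≤ (6 / Real.log b ^ 3 * 2) := by positivity
    have h12 : 0 ≤ (1 / ε₀ + 1) ^ 3 := by positivity
    nlinarith

end Moments

/-! ### Expansion of `(1 - p)⁻¹ ^ k` with remainders. -/

section Taylor

variable {p B : ℝ} {L : ℕ}

/-- This increment in `k` drives the expansions below: summing the bound of one order over `k`, with
an extra factor `p`, gives the next order. -/
theorem inv_pow_succ_eq (hp1 : p < 1) (k : ℕ) :
    (1 - p)⁻¹ ^ (k + 1) = (1 - p)⁻¹ ^ k + p * (1 - p)⁻¹ ^ (k + 1) := by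
  have : (1 - p) ≠ 0 := (sub_pos.2 hp1).ne'
  rw [pow_succ]
  field_simp
  ring

theorem inv_pow_sub_one_mem (hp0 : 0 ≤ p) (hp1 : p < 1)
    (hB : ∀ k ≤ L, (1 - p)⁻¹ ^ k ≤ B) (k : ℕ) (hk : k ≤ L) :
    0 ≤ (1 - p)⁻¹ ^ k - 1 ∧ (1 - p)⁻¹ ^ k - 1 ≤ B * (p * k) := by
  have hq := sub_pos.2 hp1
  induction k with
  | zero => simp
  | succ k ih =>
    obtain ⟨h1, h1'⟩ := ih (by omega)
    have h2 := inv_pow_succ_eq hp1 k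
    have h3 := mul_le_mul_of_nonneg_left (hB (k + 1) hk) hp0
    have h4 : 0 ≤ p * (1 - p)⁻¹ ^ (k + 1) := by positivity
    push_cast
    generalize (1 - p)⁻¹ ^ (k + 1) = b at *
    generalize (1 - p)⁻¹ ^ k = a at *
    constructor <;> linarith

theorem inv_pow_sub_linear_mem (hp0 : 0 ≤ p) (hp1 : p < 1)
    (hB : ∀ k ≤ L, (1 - p)⁻¹ ^ k ≤ B) (k : ℕ) (hk : k ≤ L) :
    0 ≤ (1 - p)⁻¹ ^ k - 1 - p * k ∧ (1 - p)⁻¹ ^ k - 1 - p * k ≤ B * (p * k) ^ 2 := by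
  have hB0 : 1 ≤ B := by simpa using hB 0 (Nat.zero_le _)
  induction k with
  | zero => simp
  | succ k ih =>
    obtain ⟨h1, h1'⟩ := ih (by omega)
    have h2 := inv_pow_succ_eq hp1 k
    have h3 := inv_pow_sub_one_mem hp0 hp1 hB (k + 1) hk
    have h4 := mul_le_mul_of_nonneg_left h3.2 hp0
    have h5 := mul_nonneg hp0 h3.1
    have h6 : 0 ≤ B * p ^ 2 * k := by positivity
    push_cast at *
    generalize (1 - p)⁻¹ ^ (k + 1) = b at *
    generalize (1 - p)⁻¹ ^ k = a at *
    constructor <;> linarith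

theorem inv_pow_sub_quadratic_mem (hp0 : 0 ≤ p) (hp1 : p < 1)
    (hB : ∀ k ≤ L, (1 - p)⁻¹ ^ k ≤ B) (k : ℕ) (hk : k ≤ L) :
    0 ≤ (1 - p)⁻¹ ^ k - 1 - p * k - p ^ 2 * (k * (k + 1)) / 2 ∧
      (1 - p)⁻¹ ^ k - 1 - p * k - p ^ 2 * (k * (k + 1)) / 2 ≤ B * (p * k) ^ 3 := by
  have hB0 : 1 ≤ B := by simpa using hB 0 (Nat.zero_le _)
  induction k with
  | zero => simp
  | succ k ih =>
    obtain ⟨h1, h1'⟩ := ih (by omega)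
    have h2 := inv_pow_succ_eq hp1 k
    have h3 := inv_pow_sub_linear_mem hp0 hp1 hB (k + 1) hk
    have h4 := mul_le_mul_of_nonneg_left h3.2 hp0
    have h5 := mul_nonneg hp0 h3.1
    have h6 : 0 ≤ B * p ^ 3 * k := by positivity
    have h7 : 0 ≤ B * p ^ 3 * k ^ 2 := by positivity
    push_cast at *
    generalize (1 - p)⁻¹ ^ (k + 1) = b at *
    generalize (1 - p)⁻¹ ^ k = a at *
    constructor <;> linarith

/-- The exponents go up to twice the largest cluster size because `q⁻¹ ^ (2 * k)` occurs when two
vertices are removed. The `4` comes from `2 * (N + 1) ≤ 4 * N`. -/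
theorem inv_pow_le_exp {lam : ℝ} (h0 : 0 < lam) (h1 : lam < 1) {N : ℕ} (hN : 0 < N) (k : ℕ)
    (hk : k ≤ 2 * (N + 1)) : (1 - lam / N)⁻¹ ^ k ≤ Real.exp (4 / (1 - lam)) := by
  have hN' : (1 : ℝ) ≤ N := by exact_mod_cast hN
  have hk' : (k : ℝ) ≤ 2 * (N + 1) := by exact_mod_cast hk
  have hd : 0 < (N : ℝ) - lam := by linarith
  have h2 : (1 - lam / N)⁻¹ = 1 + lam / (N - lam) := by
    rw [one_sub_div (by linarith : (N : ℝ) ≠ 0)]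
    field_simp
    ring
  have h3 : (1 - lam / N)⁻¹ ≤ Real.exp (lam / (N - lam)) := by
    rw [h2, add_comm]
    exact Real.add_one_le_exp _
  have h4 : 0 ≤ (1 - lam / N)⁻¹ := by rw [h2]; positivity
  refine (pow_le_pow_left₀ h4 h3 k).trans ?_
  rw [← Real.exp_nat_mul]
  refine Real.exp_le_exp.2 ?_
  rw [← mul_div_assoc, div_le_div_iff₀ hd (by linarith)]
  have h5 : (k : ℝ) * lam ≤ 4 * N * lam := mul_le_mul_of_nonneg_right (by linarith) h0.le
  have h6 : (k : ℝ) * lam * (1 - lam) ≤ 4 * N * lam * (1 - lam) :=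
    mul_le_mul_of_nonneg_right h5 (by linarith)
  have h7 : N * (1 - lam) ≤ N - lam := by nlinarith
  have h8 : 4 * N * lam * (1 - lam) ≤ 4 * (N * (1 - lam)) := by
    have : 0 ≤ N * (1 - lam) := mul_nonneg (by linarith) (by linarith)
    nlinarith
  linarith

end Taylor

/-! ### Pointwise error bounds for the expanded weights. -/

section Pointwise

variable {lam ν m K B a : ℝ}

/-- Here and below `m` is `N`, `ν` is `1 / N`, `K` is the cluster size and `a` is `q⁻¹ ^ k`. The
error is a difference of two nonnegative quantities, each within the bound, so no factor `2` is
lost. -/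
theorem abs_scaled_sub_linear_le (hm : m * ν = 1) (hν : 0 ≤ ν) (hl0 : 0 ≤ lam) (hl1 : lam ≤ 1)
    (hK : 1 ≤ K) (hB : 1 ≤ B) (hm0 : 0 ≤ m)
    (h1 : 0 ≤ a - 1 ∧ a - 1 ≤ B * (lam * ν * K))
    (h2 : 0 ≤ a - 1 - lam * ν * K ∧ a - 1 - lam * ν * K ≤ B * (lam * ν * K) ^ 2) :
    |m * ((1 - (K - 1) * ν) * a - 1) - (lam * K - (K - 1))| ≤ B * ν * K ^ 2 := by
  have he : m * ((1 - (K - 1) * ν) * a - 1) - (lam * K - (K - 1)) =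
      m * (a - 1 - lam * ν * K) - (K - 1) * (a - 1) := by
    linear_combination (lam * K - (K - 1) * a) * hm
  have hU0 := mul_nonneg hm0 h2.1
  have hV0 := mul_nonneg (sub_nonneg.2 hK) h1.1
  have hU : m * (a - 1 - lam * ν * K) ≤ B * ν * K ^ 2 := by
    have hl2 : lam ^ 2 ≤ 1 := pow_le_one₀ hl0 hl1
    calc _ ≤ m * (B * (lam * ν * K) ^ 2) := mul_le_mul_of_nonneg_left h2.2 hm0
      _ = lam ^ 2 * (B * ν * K ^ 2) := by linear_combination (lam ^ 2 * B * ν * K ^ 2) * hm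
      _ ≤ 1 * (B * ν * K ^ 2) := mul_le_mul_of_nonneg_right hl2 (by positivity)
      _ = _ := one_mul _
  have hV : (K - 1) * (a - 1) ≤ B * ν * K ^ 2 := by
    calc _ ≤ K * (B * (lam * ν * K)) :=
          mul_le_mul (by linarith) h1.2 h1.1 (by linarith)
      _ = lam * (B * ν * K ^ 2) := by ring
      _ ≤ 1 * (B * ν * K ^ 2) := mul_le_mul_of_nonneg_right hl1 (by positivity)
      _ = _ := one_mul _
  rw [he, abs_le]
  constructor <;> linarith

theorem abs_scaled_sub_quadratic_le (hm : m * ν = 1) (hν : 0 ≤ ν) (hl0 : 0 ≤ lam)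
    (hl1 : lam ≤ 1) (hK : 1 ≤ K) (hB : 1 ≤ B) (hm0 : 0 ≤ m)
    (h2 : 0 ≤ a - 1 - lam * ν * K ∧ a - 1 - lam * ν * K ≤ B * (lam * ν * K) ^ 2)
    (h3 : 0 ≤ a - 1 - lam * ν * K - (lam * ν) ^ 2 * (K * (K + 1)) / 2 ∧
      a - 1 - lam * ν * K - (lam * ν) ^ 2 * (K * (K + 1)) / 2 ≤ B * (lam * ν * K) ^ 3) :
    |m ^ 2 * ((1 - (K - 1) * ν) * a - 1) - (m * (lam * K - (K - 1)) +
      (lam ^ 2 * (K * (K + 1)) / 2 - lam * K * (K - 1)))| ≤ B * ν * K ^ 3 := by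
  have he : m ^ 2 * ((1 - (K - 1) * ν) * a - 1) - (m * (lam * K - (K - 1)) +
      (lam ^ 2 * (K * (K + 1)) / 2 - lam * K * (K - 1))) =
      m ^ 2 * (a - 1 - lam * ν * K - (lam * ν) ^ 2 * (K * (K + 1)) / 2) -
        (K - 1) * (m * (a - 1 - lam * ν * K)) := by
    linear_combination (m * lam * K - m * (K - 1) * a + lam ^ 2 * (K * (K + 1)) / 2 * (m * ν + 1)
      - (K - 1) * lam * K) * hm
  have hU0 := mul_nonneg (sq_nonneg m) h3.1
  have hV0 := mul_nonneg (sub_nonneg.2 hK) (mul_nonneg hm0 h2.1)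
  have hU : m ^ 2 * (a - 1 - lam * ν * K - (lam * ν) ^ 2 * (K * (K + 1)) / 2) ≤
      B * ν * K ^ 3 := by
    have hl3 : lam ^ 3 ≤ 1 := pow_le_one₀ hl0 hl1
    calc _ ≤ m ^ 2 * (B * (lam * ν * K) ^ 3) := mul_le_mul_of_nonneg_left h3.2 (sq_nonneg m)
      _ = lam ^ 3 * (B * ν * K ^ 3) := by
        linear_combination (lam ^ 3 * B * ν * K ^ 3 * (m * ν + 1)) * hm
      _ ≤ 1 * (B * ν * K ^ 3) := mul_le_mul_of_nonneg_right hl3 (by positivity)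
      _ = _ := one_mul _
  have hV : (K - 1) * (m * (a - 1 - lam * ν * K)) ≤ B * ν * K ^ 3 := by
    have hl2 : lam ^ 2 ≤ 1 := pow_le_one₀ hl0 hl1
    calc _ ≤ K * (m * (B * (lam * ν * K) ^ 2)) :=
          mul_le_mul (by linarith) (mul_le_mul_of_nonneg_left h2.2 hm0) (mul_nonneg hm0 h2.1)
            (by linarith)
      _ = lam ^ 2 * (B * ν * K ^ 3) := by linear_combination (lam ^ 2 * B * ν * K ^ 3) * hm
      _ ≤ 1 * (B * ν * K ^ 3) := mul_le_mul_of_nonneg_right hl2 (by positivity)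
      _ = _ := one_mul _
  rw [he, abs_le]
  constructor <;> linarith

theorem abs_scaled_sq_sub_sq_le {d w : ℝ} (hB : 1 ≤ B) (hK : 1 ≤ K) (hν : 0 ≤ ν)
    (hνK : ν * K ≤ 2) (hw : |w| ≤ K) (hd : |d - w| ≤ B * ν * K ^ 2) :
    |d ^ 2 - w ^ 2| ≤ 2 * B * (B + 1) * ν * K ^ 3 := by
  have h1 : B * ν * K ^ 2 ≤ 2 * B * K := by
    have := mul_le_mul_of_nonneg_left hνK (by positivity : 0 ≤ B * K)
    linarith
  have h2 : |d + w| ≤ 2 * (B + 1) * K := by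
    have h3 : d + w = (d - w) + (w + w) := by ring
    rw [h3]
    have h4 := abs_add_le (d - w) (w + w)
    have h5 := abs_add_le w w
    linarith
  calc |d ^ 2 - w ^ 2| = |d - w| * |d + w| := by rw [← abs_mul]; congr 1; ring
    _ ≤ (B * ν * K ^ 2) * (2 * (B + 1) * K) :=
      mul_le_mul hd h2 (abs_nonneg _) (by positivity)
    _ = _ := by ring

theorem abs_mul_sub_self_le (hν : 0 ≤ ν) (hl1 : lam ≤ 1) (hK : 1 ≤ K)
    (hB : 1 ≤ B) (hb : a * a ≤ B)
    (h1 : 0 ≤ a * a - 1 ∧ a * a - 1 ≤ B * (lam * ν * (2 * K))) :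
    |(1 - (K - 1) * ν) * a * a * (K - 1) - (K - 1)| ≤ 2 * B * ν * K ^ 2 := by
  have he : (1 - (K - 1) * ν) * a * a * (K - 1) - (K - 1) =
      (K - 1) * (a * a - 1) - (K - 1) ^ 2 * (ν * (a * a)) := by ring
  have hU0 := mul_nonneg (sub_nonneg.2 hK) h1.1
  have haa : 0 ≤ a * a := by linarith
  have hV0 : 0 ≤ (K - 1) ^ 2 * (ν * (a * a)) := by positivity
  have hU : (K - 1) * (a * a - 1) ≤ 2 * B * ν * K ^ 2 := by
    calc _ ≤ K * (B * (lam * ν * (2 * K))) :=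
          mul_le_mul (by linarith) h1.2 h1.1 (by linarith)
      _ = lam * (2 * B * ν * K ^ 2) := by ring
      _ ≤ 1 * (2 * B * ν * K ^ 2) := mul_le_mul_of_nonneg_right hl1 (by positivity)
      _ = _ := one_mul _
  have hV : (K - 1) ^ 2 * (ν * (a * a)) ≤ 2 * B * ν * K ^ 2 := by
    have h2 : (K - 1) ^ 2 ≤ K ^ 2 := pow_le_pow_left₀ (by linarith) (by linarith) 2
    calc _ ≤ K ^ 2 * (ν * B) :=
          mul_le_mul h2 (mul_le_mul_of_nonneg_left hb hν) (by positivity) (by positivity)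
      _ = B * ν * K ^ 2 := by ring
      _ ≤ 2 * B * ν * K ^ 2 := by
        have : 0 ≤ B * ν * K ^ 2 := by positivity
        linarith
  rw [he, abs_le]
  constructor <;> linarith

end Pointwise

/-! ### Approximate moment identities and their solution. -/

theorem abs_clusterMean_sub_le {p : ℝ} (hp0 : 0 ≤ p) (hp1 : p ≤ 1) {N : ℕ} {f g : ℕ → ℝ}
    {c M : ℝ} (hc : 0 ≤ c) (hM : clusterMean p N (fun k => (k : ℝ) ^ 3) ≤ M)
    (h : ∀ k : ℕ, 1 ≤ k → k ≤ N + 1 → |f k - g k| ≤ c * (k : ℝ) ^ 3) :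
    |clusterMean p N f - clusterMean p N g| ≤ c * M := by
  have hc3 := mul_le_mul_of_nonneg_left hM hc
  rw [← clusterMean_mul_left] at hc3
  have h1 : clusterMean p N f ≤ clusterMean p N (fun k => g k + c * (k : ℝ) ^ 3) :=
    clusterMean_mono hp0 hp1 fun k hk hk' => by linarith [(abs_le.1 (h k hk hk')).2]
  have h2 : clusterMean p N g ≤ clusterMean p N (fun k => f k + c * (k : ℝ) ^ 3) :=
    clusterMean_mono hp0 hp1 fun k hk hk' => by linarith [(abs_le.1 (h k hk hk')).1]
  rw [clusterMean_add] at h1 h2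
  rw [abs_le]
  constructor <;> linarith

theorem clusterMean_quadratic (p : ℝ) (N : ℕ) (c₂ c₁ c₀ : ℝ) :
    clusterMean p N (fun k => c₂ * (k : ℝ) ^ 2 + c₁ * k + c₀) =
      c₂ * clusterMean p N (fun k => (k : ℝ) ^ 2) + c₁ * clusterMean p N (fun k => (k : ℝ)) +
        c₀ := by
  rw [clusterMean_add, clusterMean_add, clusterMean_mul_left, clusterMean_mul_left,
    clusterMean_const]

/-- The moment identities satisfied by the cluster size, up to errors of order `1 / N`. -/
theorem exists_abs_moment_identities_le {lam : ℝ} (h0 : 0 < lam) (h1 : lam < 1) :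
    ∃ C : ℝ, 0 ≤ C ∧ ∀ (N : ℕ) (x y : ℝ), 0 < N →
      x = clusterMean (lam / N) N (fun k => (k : ℝ)) →
      y = clusterMean (lam / N) N (fun k => (k : ℝ) ^ 2) →
      |(1 - lam) * x - 1| ≤ C * (N : ℝ)⁻¹ ∧
      |(1 - lam) ^ 2 * y - 2 * (1 - lam) * x + 1 - (x - 1)| ≤ C * (N : ℝ)⁻¹ ∧
      |N * (1 - (1 - lam) * x) + (lam ^ 2 / 2 * (y + x) - lam * (y - x))| ≤ C * (N : ℝ)⁻¹ := by
  obtain ⟨M, hM0, hM⟩ := exists_clusterMean_cube_le h0 h1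
  set B := Real.exp (4 / (1 - lam)) with hBdef
  have hB : 1 ≤ B := Real.one_le_exp (div_nonneg (by norm_num) (by linarith))
  refine ⟨(4 * B * (B + 1) + 2 * B + 1) * M, by positivity, fun N x y hN hx hy => ?_⟩
  have hN1 : (1 : ℝ) ≤ N := by exact_mod_cast hN
  set ν : ℝ := (N : ℝ)⁻¹ with hν
  have hν0 : 0 ≤ ν := by positivity
  have hmν : (N : ℝ) * ν = 1 := mul_inv_cancel₀ (by linarith)
  have hpν : lam / N = lam * ν := div_eq_mul_inv _ _
  have hν1 : ν ≤ 1 := inv_le_one_of_one_le₀ hN1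
  have hp0 : 0 ≤ lam / N := by positivity
  have hp1 : lam / N < 1 := (div_lt_one (by linarith)).2 (by linarith)
  have hMN := hM N hN
  have hBk : ∀ k ≤ 2 * (N + 1), (1 - lam / N)⁻¹ ^ k ≤ B := fun k hk => inv_pow_le_exp h0 h1 hN k hk
  set D : ℕ → ℝ := fun k => (1 - ((k : ℝ) - 1) * ν) * (1 - lam / N)⁻¹ ^ k with hD
  -- One vertex is removed while `p` stays `lam / N`; only the total mass of the smaller law enters,
  -- so its parameter need not be rescaled.
  have hED : clusterMean (lam / N) N D = 1 := by
    obtain ⟨L, rfl⟩ : ∃ L, N = L + 1 := ⟨N - 1, by omega⟩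
    have h := clusterMean_succ hp1 L (fun _ => 1)
    rw [clusterMean_const] at h
    rw [← h]
    refine clusterMean_congr fun k _ _ => ?_
    simp only [hD, hν, div_eq_mul_inv]
    push_cast
    ring
  have e1 : ∀ k : ℕ, 1 ≤ k → k ≤ N + 1 →
      |N * (D k - 1) - (lam * k - ((k : ℝ) - 1))| ≤ B * ν * (k : ℝ) ^ 2 := by
    intro k hk hkN
    have h2 := inv_pow_sub_one_mem hp0 hp1 hBk k (by omega)
    have h3 := inv_pow_sub_linear_mem hp0 hp1 hBk k (by omega)
    have hk1 : (1 : ℝ) ≤ k := by exact_mod_cast hk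
    simp only [hD]
    rw [hpν] at *
    exact abs_scaled_sub_linear_le hmν hν0 h0.le h1.le hk1 hB (by linarith) h2 h3
  have e2 : ∀ k : ℕ, 1 ≤ k → k ≤ N + 1 →
      |(N : ℝ) ^ 2 * (D k - 1) - (N * (lam * k - ((k : ℝ) - 1)) +
        (lam ^ 2 * (k * (k + 1)) / 2 - lam * k * ((k : ℝ) - 1)))| ≤ B * ν * (k : ℝ) ^ 3 := by
    intro k hk hkN
    have h2 := inv_pow_sub_linear_mem hp0 hp1 hBk k (by omega)
    have h3 := inv_pow_sub_quadratic_mem hp0 hp1 hBk k (by omega)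
    have hk1 : (1 : ℝ) ≤ k := by exact_mod_cast hk
    simp only [hD]
    rw [hpν] at *
    exact abs_scaled_sub_quadratic_le hmν hν0 h0.le h1.le hk1 hB (by linarith) h2 h3
  have e3 : ∀ k : ℕ, 1 ≤ k → k ≤ N + 1 →
      |(N * (D k - 1)) ^ 2 - (lam * k - ((k : ℝ) - 1)) ^ 2| ≤
        2 * B * (B + 1) * ν * (k : ℝ) ^ 3 := by
    intro k hk hkN
    have hk1 : (1 : ℝ) ≤ k := by exact_mod_cast hk
    have hkN' : (k : ℝ) ≤ N + 1 := by exact_mod_cast hkN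
    refine abs_scaled_sq_sub_sq_le hB hk1 hν0 ?_ ?_ (e1 k hk hkN)
    · have := mul_le_mul_of_nonneg_left hkN' hν0
      linarith
    · rw [abs_le]
      constructor <;> nlinarith
  have e4 : ∀ k : ℕ, 1 ≤ k → k ≤ N + 1 →
      |D k * (1 - lam / N)⁻¹ ^ k * ((k : ℝ) - 1) - ((k : ℝ) - 1)| ≤
        2 * B * ν * (k : ℝ) ^ 2 := by
    intro k hk hkN
    have hk1 : (1 : ℝ) ≤ k := by exact_mod_cast hk
    have h2 := inv_pow_sub_one_mem hp0 hp1 hBk (2 * k) (by omega)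
    have h3 := hBk (2 * k) (by omega)
    rw [two_mul, pow_add, ← two_mul] at h2
    rw [two_mul, pow_add] at h3
    push_cast at h2
    simp only [hD]
    rw [hpν] at *
    exact abs_mul_sub_self_le hν0 h1.le hk1 hB h3 h2
  have hsq : ∀ k : ℕ, 1 ≤ k → (k : ℝ) ^ 2 ≤ (k : ℝ) ^ 3 := fun k hk =>
    pow_le_pow_right₀ (by exact_mod_cast hk) (by norm_num)
  have f1 := abs_clusterMean_sub_le hp0 hp1.le (by positivity : 0 ≤ B * ν) hMN
    fun k hk hkN => (e1 k hk hkN).trans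
      (mul_le_mul_of_nonneg_left (hsq k hk) (by positivity))
  have f2 := abs_clusterMean_sub_le hp0 hp1.le (by positivity : 0 ≤ B * ν) hMN e2
  have f3 := abs_clusterMean_sub_le hp0 hp1.le (by positivity : 0 ≤ 2 * B * (B + 1) * ν) hMN e3
  have f4 := abs_clusterMean_sub_le hp0 hp1.le (by positivity : 0 ≤ 2 * B * ν) hMN
    fun k hk hkN => (e4 k hk hkN).trans
      (mul_le_mul_of_nonneg_left (hsq k hk) (by positivity))
  have g1 : clusterMean (lam / N) N (fun k => N * (D k - 1)) = 0 := by
    have : (fun k => N * (D k - 1)) = fun k => N * D k + (-N : ℝ) := by ext; ring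
    rw [this, clusterMean_add, clusterMean_mul_left, hED, clusterMean_const]
    ring
  have g2 : clusterMean (lam / N) N (fun k => (N : ℝ) ^ 2 * (D k - 1)) = 0 := by
    have : (fun k => (N : ℝ) ^ 2 * (D k - 1)) = fun k => N * (N * (D k - 1)) := by ext; ring
    rw [this, clusterMean_mul_left, g1, mul_zero]
  have g3 : clusterMean (lam / N) N (fun k => lam * k - ((k : ℝ) - 1)) = 1 - (1 - lam) * x := by
    rw [hx]
    have := clusterMean_quadratic (lam / N) N 0 (lam - 1) 1
    rw [← clusterMean_congr (f := fun k => lam * k - ((k : ℝ) - 1)) fun k _ _ => by ring] at this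
    rw [this]
    ring
  have g4 : clusterMean (lam / N) N (fun k => N * (lam * k - ((k : ℝ) - 1)) +
        (lam ^ 2 * (k * (k + 1)) / 2 - lam * k * ((k : ℝ) - 1))) =
      N * (1 - (1 - lam) * x) + (lam ^ 2 / 2 * (y + x) - lam * (y - x)) := by
    rw [clusterMean_add, clusterMean_mul_left, g3, hx, hy]
    have := clusterMean_quadratic (lam / N) N (lam ^ 2 / 2 - lam) (lam ^ 2 / 2 + lam) 0
    rw [← clusterMean_congr (f := fun k : ℕ => lam ^ 2 * ((k : ℝ) * (k + 1)) / 2 -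
      lam * k * ((k : ℝ) - 1)) fun k _ _ => by ring] at this
    rw [this]
    ring
  have g5 : clusterMean (lam / N) N (fun k => (lam * k - ((k : ℝ) - 1)) ^ 2) =
      (1 - lam) ^ 2 * y - 2 * (1 - lam) * x + 1 := by
    rw [hx, hy]
    have := clusterMean_quadratic (lam / N) N ((1 - lam) ^ 2) (-(2 * (1 - lam))) 1
    rw [← clusterMean_congr (f := fun k : ℕ => (lam * k - ((k : ℝ) - 1)) ^ 2)
      fun k _ _ => by ring] at this
    rw [this]
    ring
  have g6 : clusterMean (lam / N) N (fun k => (k : ℝ) - 1) = x - 1 := by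
    rw [hx]
    have := clusterMean_quadratic (lam / N) N 0 1 (-1)
    rw [← clusterMean_congr (f := fun k : ℕ => (k : ℝ) - 1) fun k _ _ => by ring] at this
    rw [this]
    ring
  set S := clusterMean (lam / N) N (fun k => (N * (D k - 1)) ^ 2) with hS
  set T := clusterMean (lam / N) N
    (fun k => D k * (1 - lam / N)⁻¹ ^ k * ((k : ℝ) - 1)) with hT
  -- Two vertices are removed. The second factor has denominator `N - 1` instead of `N`, and this
  -- discrepancy is what makes `E[D ^ 2]` differ from one.
  have hST : N ≠ 1 → (1 - ν) * S = T := by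
    intro hN2
    obtain ⟨L, hL⟩ : ∃ L, N = L + 1 + 1 := ⟨N - 2, by omega⟩
    have hNL : (N : ℝ) = L + 1 + 1 := by rw [hL]; push_cast; ring
    have hr : (L : ℝ) + 1 ≠ 0 := by positivity
    have h := clusterMean_succ hp1 (L + 1)
      (fun k => (1 - ((k : ℝ) - 1) / (L + 1)) * ((1 - lam / N)⁻¹ ^ k * 1))
    rw [clusterMean_succ hp1 L (fun _ => 1), clusterMean_const, ← hL] at h
    have h2 : clusterMean (lam / N) N (fun k => (D k) ^ 2 +
        (-(ν / (L + 1))) * (D k * (1 - lam / N)⁻¹ ^ k * ((k : ℝ) - 1))) = 1 := by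
      refine Eq.trans (clusterMean_congr fun k _ _ => ?_) h
      simp only [hD, hν]
      generalize (1 - lam / (N : ℝ))⁻¹ ^ k = a
      rw [hNL]
      push_cast
      field_simp
      ring
    rw [clusterMean_add, clusterMean_mul_left, ← hT] at h2
    have h3 : S = (N : ℝ) ^ 2 * (clusterMean (lam / N) N (fun k => (D k) ^ 2) - 1) := by
      have : (fun k => (N * (D k - 1)) ^ 2) = fun k => (N : ℝ) ^ 2 * (D k) ^ 2 +
          ((-(2 * (N : ℝ) ^ 2)) * D k + (N : ℝ) ^ 2) := by ext; ring
      rw [hS, this, clusterMean_add, clusterMean_add, clusterMean_mul_left, clusterMean_mul_left,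
        hED, clusterMean_const]
      ring
    have h4 : clusterMean (lam / N) N (fun k => (D k) ^ 2) - 1 = ν / (L + 1) * T := by linarith
    have h5 : (1 - ν) * ((N : ℝ) ^ 2 * (ν / (L + 1))) = 1 := by
      rw [hν, hNL]
      field_simp
      ring
    rw [h3, h4]
    linear_combination T * h5
  have hw : ∀ k : ℕ, 1 ≤ k → (lam * k - ((k : ℝ) - 1)) ^ 2 ≤ (k : ℝ) ^ 3 := by
    intro k hk
    have hk1 : (1 : ℝ) ≤ k := by exact_mod_cast hk
    exact (sq_le_sq' (by nlinarith) (by nlinarith)).trans (hsq k hk)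
  have hQM : (1 - lam) ^ 2 * y - 2 * (1 - lam) * x + 1 ≤ M := by
    rw [← g5]
    exact (clusterMean_mono hp0 hp1.le fun k hk _ => hw k hk).trans hMN
  rw [g1, g3] at f1
  rw [g2, g4] at f2
  rw [g5] at f3
  rw [g6] at f4
  have hBM : 0 ≤ B * ν * M := by positivity
  have hBBM : 0 ≤ B * (B + 1) * ν * M := by positivity
  have hνM : 0 ≤ ν * M := by positivity
  have hC : (4 * B * (B + 1) + 2 * B + 1) * M * ν =
      4 * (B * (B + 1) * ν * M) + 2 * (B * ν * M) + ν * M := by ring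
  rw [hC]
  refine ⟨?_, ?_, ?_⟩
  · rw [abs_le] at f1 ⊢
    constructor <;> linarith
  -- For `N = 1` a second removal would take away `v` itself; as `ν = 1`, a crude bound by the third
  -- moment is enough.
  · by_cases hN2 : N = 1
    · have hν1 : ν = 1 := by rw [hν, hN2]; norm_num
      have h := abs_clusterMean_sub_le hp0 hp1.le zero_le_one hMN
        (f := fun k => (lam * k - ((k : ℝ) - 1)) ^ 2) (g := fun k => (k : ℝ) - 1)
        fun k hk _ => by
          have h2 := hw k hk
          have hk1 : (1 : ℝ) ≤ k := by exact_mod_cast hk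
          have h3 : (k : ℝ) ≤ (k : ℝ) ^ 3 := le_self_pow₀ hk1 (by norm_num)
          have h4 := sq_nonneg (lam * k - ((k : ℝ) - 1))
          rw [abs_le]
          constructor <;> linarith
      rw [g5, g6] at h
      rw [hν1] at hBM hBBM ⊢
      linarith
    · have hST' := hST hN2
      -- Since `S - T = ν * S`, boundedness of `S` makes `S` and `T` agree up to `O(ν)`.
      have hS0 : ν * S ≤ ν * M + 2 * (B * (B + 1) * ν * M) := by
        have h2 := (abs_le.1 f3).2
        have h3 : S ≤ M + 2 * B * (B + 1) * ν * M := by linarith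
        have h4 := mul_le_mul_of_nonneg_left h3 hν0
        have h5 := mul_le_mul_of_nonneg_right hν1 hBBM
        linarith
      have hS1 : 0 ≤ ν * S := by
        refine mul_nonneg hν0 ?_
        rw [← clusterMean_const (lam / N) N 0]
        exact clusterMean_mono hp0 hp1.le fun k _ _ => sq_nonneg _
      rw [abs_le] at f3 f4 ⊢
      constructor <;> linarith
  · rw [abs_le] at f2 ⊢
    constructor <;> linarith

/-- The identities form a triangular system: `hx` gives the leading term of `x`, `hy` then that of
`y`, and inserting both into `hxy` gives the next term of `x`. Here `ν = 1 / N` and `μ = 1 / n`;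
replacing one by the other costs `ν * μ`, which is of second order. -/
theorem abs_expansion_le {lam m ν μ C x y : ℝ} (h0 : 0 < lam) (h1 : lam < 1) (hC : 0 ≤ C)
    (hm : m * ν = 1) (hν : 0 ≤ ν) (hνμ : ν ≤ 2 * μ) (hμ : ν - μ = ν * μ)
    (hx : |(1 - lam) * x - 1| ≤ C * ν)
    (hy : |(1 - lam) ^ 2 * y - 2 * (1 - lam) * x + 1 - (x - 1)| ≤ C * ν)
    (hxy : |m * (1 - (1 - lam) * x) + (lam ^ 2 / 2 * (y + x) - lam * (y - x))| ≤ C * ν)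
    {t cw c G H : ℝ} (ht : t = 1 - lam) (hcw : cw = (3 * C + C / t) / t ^ 2)
    (hc : c = C + cw + 2 * (C / t)) (hG : G = (2 * lam ^ 2 - lam ^ 4) / (2 * t ^ 3))
    (hH : H = lam ^ 3 / (2 * t ^ 2)) :
    |x - (1 / t - G / t * μ)| ≤ (4 * c + 2 * G) / t * μ ^ 2 ∧
    |y - 1 / t ^ 3| ≤ 2 * cw * μ ∧
    |lam * ν * ((m + 1) * x - y / 2 - x / 2) - x + 1 - H * μ| ≤
      (4 * (c + C / t + cw) + 2 * H) * μ ^ 2 := by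
  have ht0 : 0 < t := by rw [ht]; linarith
  have hl2 : lam ^ 2 ≤ lam := by nlinarith
  have hl4 : lam ^ 4 ≤ lam ^ 2 := pow_le_pow_of_le_one h0.le h1.le (by norm_num)
  have hl0 : 0 ≤ lam ^ 2 := sq_nonneg lam
  have hG0 : 0 ≤ G := by
    rw [hG]
    have : 0 < lam ^ 2 := by positivity
    exact div_nonneg (by linarith) (by positivity)
  have hH0 : 0 ≤ H := by rw [hH]; positivity
  have hcw0 : 0 ≤ cw := by rw [hcw]; positivity
  have hCt : 0 ≤ C / t := by positivity
  have hc0 : 0 ≤ c := by rw [hc]; positivity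
  have hμ0 : 0 ≤ μ := by linarith
  rw [← ht] at hx hy hxy
  obtain ⟨u, hu⟩ : ∃ u, u = x - 1 / t := ⟨_, rfl⟩
  obtain ⟨w, hw⟩ : ∃ w, w = y - 1 / t ^ 3 := ⟨_, rfl⟩
  have hxu : x = 1 / t + u := by rw [hu]; ring
  have hyw : y = 1 / t ^ 3 + w := by rw [hw]; ring
  have htx : t * x - 1 = t * u := by rw [hxu]; field_simp; ring
  have hub : |u| ≤ C / t * ν := by
    rw [htx, abs_mul, abs_of_pos ht0] at hx
    rw [div_mul_eq_mul_div, le_div_iff₀ ht0]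
    linarith
  have hwb : |w| ≤ cw * ν := by
    have h2 : t ^ 2 * w = (t ^ 2 * y - 2 * t * x + 1 - (x - 1)) + 2 * (t * x - 1) + u := by
      rw [hxu, hyw]; field_simp; ring
    have h3 : |t ^ 2 * w| ≤ (3 * C + C / t) * ν := by
      rw [h2]
      rw [abs_le] at *
      constructor <;> linarith
    rw [abs_mul, abs_of_pos (pow_pos ht0 2)] at h3
    rw [hcw, div_mul_eq_mul_div, le_div_iff₀ (pow_pos ht0 2)]
    linarith
  have hmain : |1 - t * x + ν * -G| ≤ c * ν ^ 2 := by
    have hGid : -G = (lam ^ 2 / 2 - lam) / t ^ 3 + (lam ^ 2 / 2 + lam) / t := by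
      rw [hG, ht]
      have : 1 - lam ≠ 0 := by linarith
      field_simp
      ring
    have h2 : 1 - t * x + ν * -G =
        ν * (m * (1 - t * x) + (lam ^ 2 / 2 * (y + x) - lam * (y - x))) -
          ν * ((lam ^ 2 / 2 - lam) * w) - ν * ((lam ^ 2 / 2 + lam) * u) := by
      rw [hGid]
      linear_combination (-(1 - t * x)) * hm + ν * (lam ^ 2 / 2 - lam) * hw +
        ν * (lam ^ 2 / 2 + lam) * hu
    have h3 : |ν * (m * (1 - t * x) + (lam ^ 2 / 2 * (y + x) - lam * (y - x)))| ≤ C * ν ^ 2 := by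
      rw [abs_mul, abs_of_nonneg hν]
      have := mul_le_mul_of_nonneg_left hxy hν
      linarith
    have h4 : |ν * ((lam ^ 2 / 2 - lam) * w)| ≤ cw * ν ^ 2 := by
      rw [abs_mul, abs_of_nonneg hν, abs_mul]
      have hA : |lam ^ 2 / 2 - lam| ≤ 1 := by rw [abs_le]; constructor <;> linarith
      have h5 := mul_le_mul hA hwb (abs_nonneg _) zero_le_one
      have := mul_le_mul_of_nonneg_left h5 hν
      linarith
    have h5 : |ν * ((lam ^ 2 / 2 + lam) * u)| ≤ 2 * (C / t) * ν ^ 2 := by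
      rw [abs_mul, abs_of_nonneg hν, abs_mul]
      have hA : |lam ^ 2 / 2 + lam| ≤ 2 := by rw [abs_le]; constructor <;> linarith
      have h5 := mul_le_mul hA hub (abs_nonneg _) (by norm_num)
      have := mul_le_mul_of_nonneg_left h5 hν
      linarith
    rw [h2, hc]
    rw [abs_le] at h3 h4 h5 ⊢
    constructor <;> linarith
  have hν2 : ν ^ 2 ≤ 4 * μ ^ 2 := by linarith [pow_le_pow_left₀ hν hνμ 2]
  have hνμ2 : ν * μ ≤ 2 * μ ^ 2 := by linarith [mul_le_mul_of_nonneg_right hνμ hμ0]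
  have hνμ0 : 0 ≤ ν * μ := by positivity
  refine ⟨?_, ?_, ?_⟩
  · have h2 : t * (x - (1 / t - G / t * μ)) = -(1 - t * x + ν * -G) - G * (ν * μ) := by
      rw [← hμ]; field_simp; ring
    have h3 : |t * (x - (1 / t - G / t * μ))| ≤ (4 * c + 2 * G) * μ ^ 2 := by
      have h4 := mul_le_mul_of_nonneg_left hν2 hc0
      have h5 := mul_le_mul_of_nonneg_left hνμ2 hG0
      have h6 := mul_nonneg hG0 hνμ0
      rw [h2]
      rw [abs_le] at hmain ⊢
      constructor <;> linarith
    rw [abs_mul, abs_of_pos ht0] at h3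
    rw [div_mul_eq_mul_div ((4 : ℝ) * c + 2 * G), le_div_iff₀ ht0]
    linarith
  · rw [← hw]
    have := mul_le_mul_of_nonneg_left hνμ hcw0
    linarith
  -- As `m * ν = 1`, the surplus expression is `1 - t * x + lam / 2 * ν * (x - y)`; its `ν`
  -- coefficient combines `G` with the leading terms of `x` and `y`.
  · have hHid : H = G + lam / 2 * (1 / t - 1 / t ^ 3) := by
      rw [hH, hG, ht]
      have : 1 - lam ≠ 0 := by linarith
      field_simp
      ring
    have h2 : lam * ν * ((m + 1) * x - y / 2 - x / 2) - x + 1 - H * μ =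
        (1 - t * x + ν * -G) + lam / 2 * (ν * u) - lam / 2 * (ν * w) + H * (ν * μ) := by
      rw [← hμ]
      linear_combination lam * x * hm + x * ht - ν * hHid - lam / 2 * ν * hu + lam / 2 * ν * hw
    have hl : lam / 2 ≤ 1 := by linarith
    have h3 : |lam / 2 * (ν * u)| ≤ C / t * ν ^ 2 := by
      rw [abs_mul, abs_mul, abs_of_nonneg hν, abs_of_pos (by positivity : 0 < lam / 2)]
      have h4 := mul_le_mul_of_nonneg_left hub hν
      have h5 := mul_le_mul hl h4 (by positivity) zero_le_one
      linarith
    have h4 : |lam / 2 * (ν * w)| ≤ cw * ν ^ 2 := by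
      rw [abs_mul, abs_mul, abs_of_nonneg hν, abs_of_pos (by positivity : 0 < lam / 2)]
      have h4 := mul_le_mul_of_nonneg_left hwb hν
      have h5 := mul_le_mul hl h4 (by positivity) zero_le_one
      linarith
    have h5 := mul_le_mul_of_nonneg_left hν2 (by positivity : 0 ≤ c + C / t + cw)
    have h6 := mul_le_mul_of_nonneg_left hνμ2 hH0
    have h7 := mul_nonneg hH0 hνμ0
    rw [h2]
    rw [abs_le] at hmain h3 h4 ⊢
    constructor <;> linarith

/-- For fixed `0 < lam < 1` there is a constant `K` (the constant of the three error terms) such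
that the bounds hold for every `n ≥ 2`, for `p = lam / (n - 1)` and for every vertex `v`. -/
theorem theorem1p2 (lam : ℝ) (hlam0 : 0 < lam) (hlam1 : lam < 1) :
    ∃ K : ℝ, ∀ n : ℕ, 2 ≤ n → ∀ p : unitInterval, (p : ℝ) = lam / ((n : ℝ) - 1) →
      ∀ v : Fin n,
        |susceptibility n p v -
            (1 / (1 - lam) - (2 * lam ^ 2 - lam ^ 4) / (2 * (1 - lam) ^ 4) * (n : ℝ)⁻¹)|
          ≤ K * ((n : ℝ) ^ 2)⁻¹ ∧
        |(∫ G, (clusterSize G v : ℝ) ^ 2 ∂(SimpleGraph.binomialRandom (Fin n) p)) -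
            1 / (1 - lam) ^ 3|
          ≤ K * (n : ℝ)⁻¹ ∧
        |(∫ G, (surplus (cluster G v) : ℝ) ∂(SimpleGraph.binomialRandom (Fin n) p)) -
            lam ^ 3 / (2 * (1 - lam) ^ 2) * (n : ℝ)⁻¹|
          ≤ K * ((n : ℝ) ^ 2)⁻¹ := by
  obtain ⟨C, hC0, hC⟩ := exists_abs_moment_identities_le hlam0 hlam1
  obtain ⟨t, ht⟩ : ∃ t, t = 1 - lam := ⟨_, rfl⟩
  obtain ⟨cw, hcw⟩ : ∃ cw, cw = (3 * C + C / t) / t ^ 2 := ⟨_, rfl⟩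
  obtain ⟨c, hc⟩ : ∃ c, c = C + cw + 2 * (C / t) := ⟨_, rfl⟩
  obtain ⟨G, hG⟩ : ∃ G, G = (2 * lam ^ 2 - lam ^ 4) / (2 * t ^ 3) := ⟨_, rfl⟩
  obtain ⟨H, hH⟩ : ∃ H, H = lam ^ 3 / (2 * t ^ 2) := ⟨_, rfl⟩
  refine ⟨max (max ((4 * c + 2 * G) / t) (2 * cw)) (4 * (c + C / t + cw) + 2 * H),
    fun n hn p hp v => ?_⟩
  obtain ⟨N, rfl⟩ : ∃ N, n = N + 1 := ⟨n - 1, by omega⟩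
  have hN : 0 < N := by omega
  have hN1 : (1 : ℝ) ≤ N := by exact_mod_cast hN
  have hpN : (p : ℝ) = lam / N := by rw [hp]; push_cast; rw [add_sub_cancel_right]
  have hcast : ((N + 1 : ℕ) : ℝ) = (N : ℝ) + 1 := by push_cast; ring
  obtain ⟨x, hx⟩ : ∃ x, x = clusterMean (lam / N) N (fun k => (k : ℝ)) := ⟨_, rfl⟩
  obtain ⟨y, hy⟩ : ∃ y, y = clusterMean (lam / N) N (fun k => (k : ℝ) ^ 2) := ⟨_, rfl⟩
  have hIx : susceptibility (N + 1) p v = x := by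
    rw [susceptibility, integral_clusterSize p v (fun k => (k : ℝ)), hpN, hx]
  have hIy : ∫ G, (clusterSize G v : ℝ) ^ 2 ∂(SimpleGraph.binomialRandom (Fin (N + 1)) p) = y := by
    rw [integral_clusterSize p v (fun k => (k : ℝ) ^ 2), hpN, hy]
  have hIs : ∫ G, (surplus (cluster G v) : ℝ) ∂(SimpleGraph.binomialRandom (Fin (N + 1)) p) =
      lam * (N : ℝ)⁻¹ * (((N : ℝ) + 1) * x - y / 2 - x / 2) - x + 1 := by
    have h := clusterMean_quadratic (lam / N) N (-(lam / N / 2))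
      (lam / N * (N + 1 / 2) - 1) 1
    rw [integral_surplus, hpN, hx, hy]
    refine (clusterMean_congr fun k _ _ => ?_).trans (h.trans ?_)
    · ring
    · rw [div_eq_mul_inv]
      ring
  obtain ⟨b1, b2, b3⟩ := hC N x y hN hx hy
  have hν : (N : ℝ) * (N : ℝ)⁻¹ = 1 := mul_inv_cancel₀ (by linarith)
  obtain ⟨r1, r2, r3⟩ := abs_expansion_le (μ := ((N : ℝ) + 1)⁻¹) hlam0 hlam1 hC0 hν (by positivity)
    (by rw [← div_eq_mul_inv, inv_le_comm₀ (by positivity) (by positivity), inv_div,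
          div_le_iff₀ (by norm_num)]; linarith)
    (by field_simp; ring) b1 b2 b3 ht hcw hc hG hH
  have hGt : (2 * lam ^ 2 - lam ^ 4) / (2 * (1 - lam) ^ 4) = G / t := by
    rw [hG, div_div, ht]
    congr 1
    ring
  rw [hIx, hIy, hIs, hGt, ← ht, ← hH, hcast, ← inv_pow]
  refine ⟨r1.trans ?_, r2.trans ?_, r3.trans ?_⟩
  · exact mul_le_mul_of_nonneg_right ((le_max_left _ _).trans (le_max_left _ _)) (by positivity)
  · exact mul_le_mul_of_nonneg_right ((le_max_right _ _).trans (le_max_left _ _)) (by positivity)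
  · exact mul_le_mul_of_nonneg_right (le_max_right _ _) (by positivity)
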